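/- A model of set theory here is any structure $(V,E)$ (well-founded or not) satisfying the axioms of $\mathrm{ZF}$; the axiom of choice is not needed, so models of $\mathrm{ZFC}$ are included. A subuniverse of $(V,E)$ is a subclass $W\subseteq V$ that is transitive ($y\in W$ and $x\,E\,y$ imply $x\in W$) and such that $(W,E{\restriction}W)$ is also a model of $\mathrm{ZF}$; in particular every inner model of $V$ is a subuniverse. In any such model, let $(\omega)^{<\omega}$ be the set of finite strictly increasing sequences of natural numbers, and let the reals be the elements of $(\omega)^{\omega}$, the infinite strictly increasing sequences of natural numbers. A subtree of $(\omega)^{<\omega}$ is a nonempty subset $T$ closed under initial segments. Such a $T$ is superperfect if every $s\in T$ has an extension $t\in T$ (possibly $t=s$) for which $\{k\in\omega : t^\frown k\in T\}$ is infinite. A branch of $T$ is a real all of whose finite initial segments belong to $T$. **Corollary.** Let $V$ be a model of set theory and let $W$ be a subuniverse of $V$. Suppose that $V$ contains a set $T$ which is, in $V$, a superperfect tree, and that every branch of $T$ in $V$ is an element of $W$. Then $V$ and $W$ have the same reals: the reals in the sense of $V$ are exactly the reals in the sense of $W$. -/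

import Mathlib

/-! Models of set theory are structures `(M, E)`, where `M` is a type and `E x y` is the
membership relation of the model. All notions below are evaluated inside `(M, E)`: every
quantifier over sets ranges over `M`. -/

namespace SetModel

universe u

/-- The only symbol of the language of set theory is a binary relation symbol. -/
inductive MemRel : ℕ → Type
  | mem : MemRel 2

/-- The first-order language of set theory. -/
def setLang : FirstOrder.Language where
  Functions := fun _ => Empty
  Relations := MemRel

/-- `(M, E)` as a structure for the language of set theory. -/
@[reducible] def setStructure {M : Type u} (E : M → M → Prop) : setLang.Structure M where
  funMap := fun {_} f => f.elim
  RelMap := fun {_} r => match r with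
    | MemRel.mem => fun v => E (v 0) (v 1)

/-- `(M, E) ⊨ φ[v]`. -/
def Sat {M : Type u} (E : M → M → Prop) {n : ℕ} (φ : setLang.Formula (Fin n))
    (v : Fin n → M) : Prop :=
  @FirstOrder.Language.Formula.Realize setLang M (setStructure E) (Fin n) φ v

variable {M : Type u} (E : M → M → Prop)

/-- `x ⊆ y`. -/
def IsSubset (x y : M) : Prop := ∀ z, E z x → E z y

/-- `e = ∅`. -/
def IsEmptySet (e : M) : Prop := ∀ x, ¬ E x e

/-- `s = x ∪ {x}`. -/
def IsSucc (s x : M) : Prop := ∀ y, E y s ↔ E y x ∨ y = x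

/-- `a` contains `∅` and is closed under `x ↦ x ∪ {x}`. -/
def IsInductive (a : M) : Prop :=
  (∃ e, IsEmptySet E e ∧ E e a) ∧ ∀ x, E x a → ∃ s, IsSucc E s x ∧ E s a

/-- `(M, E)` is a model of Zermelo-Fraenkel set theory (without the axiom of choice).
Separation and replacement are the full schemes, over all first-order formulas of the language
of set theory with parameters. -/
structure IsModelZF : Prop where
  extensionality : ∀ a b, (∀ x, E x a ↔ E x b) → a = b
  foundation : ∀ a, (∃ x, E x a) → ∃ x, E x a ∧ ∀ y, E y x → ¬ E y a
  pairing : ∀ a b, ∃ c, ∀ x, E x c ↔ x = a ∨ x = b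
  union : ∀ a, ∃ b, ∀ x, E x b ↔ ∃ y, E y a ∧ E x y
  powerset : ∀ a, ∃ b, ∀ x, E x b ↔ IsSubset E x a
  infinity : ∃ a, IsInductive E a
  separation : ∀ (n : ℕ) (φ : setLang.Formula (Fin (n + 1))) (p : Fin n → M) (a : M),
    ∃ b, ∀ x, E x b ↔ E x a ∧ Sat E φ (Fin.cons x p : Fin (n + 1) → M)
  replacement : ∀ (n : ℕ) (φ : setLang.Formula (Fin (n + 2))) (p : Fin n → M) (a : M),
    (∀ x, E x a → ∃! y, Sat E φ (Fin.cons x (Fin.cons y p : Fin (n + 1) → M) : Fin (n + 2) → M)) →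
    ∃ b, ∀ y, E y b ↔
      ∃ x, E x a ∧ Sat E φ (Fin.cons x (Fin.cons y p : Fin (n + 1) → M) : Fin (n + 2) → M)

/-- The membership relation of `M` restricted to a subclass `W`. -/
def restrict (W : Set M) : W → W → Prop := fun x y => E x y

/-- `W` is a subuniverse of `(M, E)`: a transitive subclass that, with the membership relation of
`M`, is itself a model of set theory. Neither definability of `W` in `M` nor that `W` contains all
ordinals of `M` is required. -/
structure IsSubuniverse (W : Set M) : Prop where
  transitive : ∀ x y, y ∈ W → E x y → x ∈ W
  isModelZF : IsModelZF (restrict E W)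

/-- `n` is a natural number: a member of every inductive set. -/
def IsNat (n : M) : Prop := ∀ a, IsInductive E a → E n a

/-- `w` is the set `ω` of all natural numbers. -/
def IsOmega (w : M) : Prop := ∀ n, E n w ↔ IsNat E n

/-- `p` is the (Kuratowski) ordered pair `{{a}, {a, b}}`. -/
def IsPair (p a b : M) : Prop :=
  ∃ u v, (∀ x, E x u ↔ x = a) ∧ (∀ x, E x v ↔ x = a ∨ x = b) ∧ ∀ x, E x p ↔ x = u ∨ x = v

/-- `(a, b) ∈ f`; for a function `f` this says `f(a) = b`. -/
def Maps (f a b : M) : Prop := ∃ p, IsPair E p a b ∧ E p f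

/-- `f` is a strictly increasing function from `d` to `ω`, where `d` is `ω` or a natural number
(so that membership is the usual order on `d` and on `ω`). -/
def IsIncreasingOn (d f : M) : Prop :=
  (∀ p, E p f → ∃ n k, E n d ∧ IsNat E k ∧ IsPair E p n k) ∧
  (∀ n, E n d → ∃! k, Maps E f n k) ∧
  ∀ m n a b, E m n → Maps E f m a → Maps E f n b → E a b

/-- `s` is a finite increasing sequence of natural numbers, of length `d`. -/
def IsFinSeqOfLength (s d : M) : Prop := IsNat E d ∧ IsIncreasingOn E d s

/-- `s ∈ (ω)^{<ω}`. -/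
def IsFinSeq (s : M) : Prop := ∃ d, IsFinSeqOfLength E s d

/-- `x` is a real, `x ∈ (ω)^ω`: an infinite increasing sequence of natural numbers. -/
def IsReal (x : M) : Prop := ∃ w, IsOmega E w ∧ IsIncreasingOn E w x

/-- `T` is a (nonempty) subtree of `(ω)^{<ω}`. For finite sequences, inclusion of graphs is
the relation of being an initial segment. -/
def IsTree (T : M) : Prop :=
  (∃ s, E s T) ∧ (∀ s, E s T → IsFinSeq E s) ∧
  ∀ s t, E t T → IsFinSeq E s → IsSubset E s t → E s T

/-- `t` is the concatenation of the finite sequence `s` with the one-term sequence `k`. -/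
def IsAppend (t s k : M) : Prop :=
  ∃ d, IsFinSeqOfLength E s d ∧ ∀ p, E p t ↔ E p s ∨ IsPair E p d k

/-- The node `s` is `ω`-splitting in `T`: the set of `k ∈ ω` such that `s ⌢ k ∈ T` is
infinite, that is, unbounded in `ω`. -/
def IsOmegaSplitting (T s : M) : Prop :=
  ∀ m, IsNat E m → ∃ k, IsNat E k ∧ E m k ∧ ∃ t, IsAppend E t s k ∧ E t T

/-- `T` is a superperfect tree. -/
def IsSuperperfectTree (T : M) : Prop :=
  IsTree E T ∧ ∀ s, E s T → ∃ t, E t T ∧ IsSubset E s t ∧ IsOmegaSplitting E T t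

/-- `f` is an (infinite) branch of `T`: all its finite initial segments are in `T`. -/
def IsBranch (T f : M) : Prop :=
  IsReal E f ∧ ∀ s, IsFinSeq E s → IsSubset E s f → E s T

/-- The reals of `(M, E)`. -/
def reals : Set M := {x | IsReal E x}

end SetModel

namespace SetModel

universe u

open FirstOrder Language

/-! ### Definability with parameters -/

section Definability

variable {M : Type u} (E : M → M → Prop)

/-! Reals of `W` are reals of `V` because a transitive submodel computes `ω` correctly
(`isNat_restrict`, `isReal_restrict`). For the converse, a real `r` of `V` is coded into three
branches of `T`, which lie in `W` by hypothesis, and is then decoded inside `W`.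

Coding (`exists_interlaced`): three splitting nodes `a`, `b`, `c` of `T`, approximating branches
`x`, `y`, `z`, are extended in stages. At stage `n` all values so far lie below `μ(n)`. First `b` is
extended with new values at least `μ(n)`; then `c` is extended with new values beyond those of `b`,
but only if `n` is a value of `r`; then `a` is extended with new values beyond all of these. The
next bound is `μ(n + 1)`. Superperfectness gives extensions whose new values exceed any prescribed
bound, and no finer control of the values is needed. Choosing the least extension
(`exists_leastExtends`) makes the construction definable, so `exists_rec` applies and the axiom of
choice is avoided.

Decoding (`Interlaced.starts_and_marked`, `Interlaced.mem`): let `β(n)` be the first value of `x` in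
the interval from `μ(n)` to `μ(n + 1)`. The numbers `β(n)` are exactly the values of `x` that come
next after some value of `y` not below `μ(0)`, and `n` is a value of `r` exactly when a value of `z`
occurs between the preceding such number and `β(n)`. Thus `W` can define the ranges of `β` and of `β
∘ r` from `x`, `y`, `z` and the single number `μ(0)`; the real `μ` itself is not needed. A real is
determined by its range, so `β` and `β ∘ r` are in `W`, and hence so is `r`.

The model may be ill-founded and its `ω` nonstandard. All inductions and recursions are therefore
internal and apply only to definable predicates; the class `Dfn` lets instance search certify
definability. -/

/-- `(M, E) ⊨ φ[v]` for an arbitrary type of variables. -/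
def Holds {α : Type*} (φ : setLang.Formula α) (v : α → M) : Prop :=
  @Formula.Realize setLang M (setStructure E) α φ v

/-- Environments assign sets to de Bruijn indices; `sh` forgets the innermost variable. -/
def sh (v : ℕ → M) : ℕ → M := fun i => v (i + 1)

/-- The environment obtained from `v` by binding a new innermost variable to `x`. -/
def bind (x : M) (v : ℕ → M) : ℕ → M := fun i => Nat.casesOn i x v

/-- The predicate `P` on environments is first-order definable with parameters. -/
class Dfn (P : (ℕ → M) → Prop) : Prop where
  out : ∃ φ : setLang.Formula (M ⊕ ℕ), ∀ v, P v ↔ Holds E φ (Sum.elim id v)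

/-- `σ` drops finitely many of the innermost variables. -/
class DfnShift (σ : (ℕ → M) → ℕ → M) : Prop where
  out : ∃ k, ∀ v i, σ v i = v (i + k)

/-- `t` is a variable or a parameter. -/
class DfnTerm (t : (ℕ → M) → M) : Prop where
  out : ∃ x : M ⊕ ℕ, ∀ v, t v = Sum.elim id v x

instance DfnShift.refl : DfnShift (fun v : ℕ → M => v) := ⟨0, fun _ _ => rfl⟩

instance DfnShift.comp_sh (σ : (ℕ → M) → ℕ → M) [h : DfnShift σ] :
    DfnShift (fun v => sh (σ v)) := by
  obtain ⟨k, hk⟩ := h.out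
  exact ⟨k + 1, fun v i => by simp only [SetModel.sh, hk]; congr 1; omega⟩

instance DfnShift.base : DfnShift (sh : (ℕ → M) → ℕ → M) := ⟨1, fun _ _ => rfl⟩

instance DfnTerm.param (c : M) : DfnTerm (fun _ : ℕ → M => c) := ⟨Sum.inl c, fun _ => rfl⟩

instance DfnTerm.var (σ : (ℕ → M) → ℕ → M) [h : DfnShift σ] (i : ℕ) :
    DfnTerm (fun v => σ v i) := by
  obtain ⟨k, hk⟩ := h.out
  exact ⟨Sum.inr (i + k), fun v => hk v i⟩

variable {E}

instance Dfn.mem (s t : (ℕ → M) → M) [hs : DfnTerm s] [ht : DfnTerm t] :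
    Dfn E (fun v => E (s v) (t v)) := by
  obtain ⟨x, hx⟩ := hs.out
  obtain ⟨y, hy⟩ := ht.out
  refine ⟨Relations.formula (L := setLang) (n := 2) (show setLang.Relations 2 from MemRel.mem)
    ![Term.var x, Term.var y], fun v => ?_⟩
  let _ := setStructure E
  refine Iff.trans ?_ Formula.realize_rel.symm
  rw [hx, hy]
  rfl

instance Dfn.eq (s t : (ℕ → M) → M) [hs : DfnTerm s] [ht : DfnTerm t] :
    Dfn E (fun v => s v = t v) := by
  obtain ⟨x, hx⟩ := hs.out
  obtain ⟨y, hy⟩ := ht.out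
  refine ⟨Term.equal (Term.var x) (Term.var y), fun v => ?_⟩
  let _ := setStructure E
  rw [Holds, Formula.realize_equal, hx, hy]
  rfl

instance Dfn.not (P : (ℕ → M) → Prop) [hP : Dfn E P] : Dfn E (fun v => ¬ P v) := by
  obtain ⟨φ, hφ⟩ := hP.out
  refine ⟨φ.not, fun v => ?_⟩
  let _ := setStructure E
  rw [Holds, Formula.realize_not, hφ]
  rfl

instance Dfn.and (P Q : (ℕ → M) → Prop) [hP : Dfn E P] [hQ : Dfn E Q] :
    Dfn E (fun v => P v ∧ Q v) := by
  obtain ⟨φ, hφ⟩ := hP.out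
  obtain ⟨ψ, hψ⟩ := hQ.out
  refine ⟨φ ⊓ ψ, fun v => ?_⟩
  let _ := setStructure E
  rw [Holds, Formula.realize_inf, hφ, hψ]
  rfl

theorem Dfn.congr {P : (ℕ → M) → Prop} (Q : (ℕ → M) → Prop) [hQ : Dfn E Q]
    (h : ∀ v, P v ↔ Q v) : Dfn E P := by
  obtain rfl : P = Q := funext fun v => propext (h v)
  exact hQ

instance Dfn.imp (P Q : (ℕ → M) → Prop) [Dfn E P] [Dfn E Q] :
    Dfn E (fun v => P v → Q v) :=
  Dfn.congr (fun v => ¬ (P v ∧ ¬ Q v)) fun v => by tauto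

instance Dfn.or (P Q : (ℕ → M) → Prop) [Dfn E P] [Dfn E Q] :
    Dfn E (fun v => P v ∨ Q v) :=
  Dfn.congr (fun v => ¬ (¬ P v ∧ ¬ Q v)) fun v => by tauto

instance Dfn.iff (P Q : (ℕ → M) → Prop) [Dfn E P] [Dfn E Q] :
    Dfn E (fun v => P v ↔ Q v) :=
  Dfn.congr (fun v => (P v → Q v) ∧ (Q v → P v)) fun v => by tauto

/-- De Bruijn index 0 becomes the quantified variable and every other index moves down by one;
parameters are untouched. -/
instance Dfn.ex (P : (ℕ → M) → M → Prop) [hP : Dfn E (fun v => P (sh v) (v 0))] :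
    Dfn E (fun v => ∃ x, P v x) := by
  obtain ⟨φ, hφ⟩ := hP.out
  refine ⟨Formula.iExs Unit (φ.relabel fun a : M ⊕ ℕ => match a with
    | Sum.inl c => (Sum.inl (Sum.inl c) : (M ⊕ ℕ) ⊕ Unit)
    | Sum.inr 0 => Sum.inr ()
    | Sum.inr (i + 1) => Sum.inl (Sum.inr i)), fun v => ?_⟩
  let _ := setStructure E
  rw [Holds, Formula.realize_iExs]
  have key : ∀ f : Unit → M, P v (f ()) ↔ Holds E φ (Sum.elim id (bind (f ()) v)) := fun f => by
    rw [← hφ]; rfl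
  have : (∃ x, P v x) ↔ ∃ f : Unit → M, P v (f ()) :=
    ⟨fun ⟨x, hx⟩ => ⟨fun _ => x, hx⟩, fun ⟨f, hf⟩ => ⟨f (), hf⟩⟩
  rw [this]
  refine exists_congr fun f => (key f).trans ?_
  rw [Holds, Formula.realize_relabel]
  refine iff_of_eq (congrArg _ (funext fun a => ?_))
  rcases a with c | _ | i <;> rfl

instance Dfn.all (P : (ℕ → M) → M → Prop) [Dfn E (fun v => P (sh v) (v 0))] :
    Dfn E (fun v => ∀ x, P v x) :=
  Dfn.congr (fun v => ¬ ∃ x, ¬ P v x) fun v => by push Not; rfl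

/-- Two definability hypotheses are needed because unique existence uses `P` under one binder and,
in the uniqueness clause, under two. -/
instance Dfn.exUnique (P : (ℕ → M) → M → Prop) [Dfn E (fun v => P (sh v) (v 0))]
    [Dfn E (fun v => P (sh (sh v)) (v 0))] :
    Dfn E (fun v => ∃! x, P v x) :=
  have : Dfn E (fun v => ∀ y, P (sh v) y → y = v 0) := Dfn.all fun v y => P (sh v) y → y = v 0
  Dfn.congr (fun v => ∃ x, P v x ∧ ∀ y, P v y → y = x) fun _ => Iff.rfl

instance DfnTerm.comp (s : (ℕ → M) → M) (σ : (ℕ → M) → ℕ → M) [h : DfnTerm s] [h' : DfnShift σ] :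
    DfnTerm (fun v => s (σ v)) := by
  obtain ⟨k, hk⟩ := h'.out
  obtain ⟨x | i, hx⟩ := h.out
  · exact ⟨Sum.inl x, fun v => hx _⟩
  · exact ⟨Sum.inr (i + k), fun v => (hx _).trans (hk v i)⟩

variable (s t r : (ℕ → M) → M) [DfnTerm s] [DfnTerm t] [DfnTerm r]

instance : Dfn E (fun v => IsSubset E (s v) (t v)) := by unfold IsSubset; infer_instance
instance : Dfn E (fun v => IsEmptySet E (s v)) := by unfold IsEmptySet; infer_instance
instance : Dfn E (fun v => IsSucc E (s v) (t v)) := by unfold IsSucc; infer_instance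
instance : Dfn E (fun v => IsInductive E (s v)) := by unfold IsInductive; infer_instance
instance : Dfn E (fun v => IsNat E (s v)) := by unfold IsNat; infer_instance
instance : Dfn E (fun v => IsPair E (s v) (t v) (r v)) := by unfold IsPair; infer_instance
instance : Dfn E (fun v => Maps E (s v) (t v) (r v)) := by unfold Maps; infer_instance
instance : Dfn E (fun v => IsIncreasingOn E (s v) (t v)) := by
  unfold IsIncreasingOn; infer_instance
instance : Dfn E (fun v => IsFinSeqOfLength E (s v) (t v)) := by
  unfold IsFinSeqOfLength; infer_instance
instance : Dfn E (fun v => IsFinSeq E (s v)) := by unfold IsFinSeq; infer_instance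
instance : Dfn E (fun v => IsAppend E (s v) (t v) (r v)) := by unfold IsAppend; infer_instance
instance : Dfn E (fun v => IsOmegaSplitting E (s v) (t v)) := by
  unfold IsOmegaSplitting; infer_instance

/-- A formula has finitely many free variables, so finitely many parameters suffice. This connects
`Dfn` with the axiom schemes, which are stated for finite lists of parameters. -/
theorem exists_formula (φ : setLang.Formula (M ⊕ ℕ)) (d : M) :
    ∃ (k : ℕ) (p : Fin k → M) (ψ : setLang.Formula (Fin (k + 2))), ∀ x y,
      Holds E φ (Sum.elim id (bind x (bind y fun _ => d))) ↔
        Sat E ψ (Fin.cons x (Fin.cons y p : Fin (k + 1) → M) : Fin (k + 2) → M) := by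
  classical
  let _ := setStructure E
  let e := φ.freeVarFinset.equivFin
  refine ⟨φ.freeVarFinset.card, fun i => Sum.elim id (fun _ => d) (e.symm i).1,
    -- Indices 0 and 1 get the two distinguished slots. Every other free symbol reads its own
    -- parameter slot, which holds the default `d` for indices from 2 on.
    φ.restrictFreeVar fun a => match a.1 with
      | Sum.inr 0 => 0
      | Sum.inr 1 => 1
      | _ => (e a).succ.succ, fun x y => ?_⟩
  rw [Holds, Sat, Formula.Realize, Formula.Realize]
  refine (BoundedFormula.realize_restrictFreeVar _ ?_).symm
  rintro ⟨c | _ | _ | i, ha⟩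
  · simp
  · rfl
  · rfl
  · simp [bind]

end Definability

/-! ### Elementary set theory in a model -/

section Basic

variable {M : Type u} {E : M → M → Prop}

theorem IsPair.inj {p a b c d : M} (h : IsPair E p a b) (h' : IsPair E p c d) :
    a = c ∧ b = d := by
  obtain ⟨u, v, hu, hv, hp⟩ := h
  obtain ⟨u', v', hu', hv', hq⟩ := h'
  have key : ∀ x, x = u ∨ x = v ↔ x = u' ∨ x = v' := fun x => by rw [← hp, ← hq]
  have h1 := (key u).1 (Or.inl rfl)
  have h2 := (key v).1 (Or.inr rfl)
  have h3 := (key u').2 (Or.inl rfl)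
  have h4 := (key v').2 (Or.inr rfl)
  have hac : a = c := by
    rcases h1 with rfl | rfl
    · exact (hu' a).1 ((hu a).2 rfl)
    · exact ((hu c).1 ((hv' c).2 (Or.inl rfl))).symm
  subst hac
  refine ⟨rfl, ?_⟩
  have e1 : ∀ {w z : M}, w = z → (∀ x, E x w ↔ E x z) := fun h x => by rw [h]
  have A : b = a ∨ b = d := by
    rcases h2 with h | h
    · exact Or.inl ((hu' b).1 ((e1 h b).1 ((hv b).2 (Or.inr rfl))))
    · exact (hv' b).1 ((e1 h b).1 ((hv b).2 (Or.inr rfl)))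
  have B : d = a ∨ d = b := by
    rcases h4 with h | h
    · exact Or.inl ((hu d).1 ((e1 h d).1 ((hv' d).2 (Or.inr rfl))))
    · exact (hv d).1 ((e1 h d).1 ((hv' d).2 (Or.inr rfl)))
  rcases A with h | h
  · rcases B with h' | h' <;> simp [h, h']
  · exact h

variable [hM : Fact (IsModelZF E)]

theorem exists_sep (P : M → Prop) [hP : Dfn E fun v => P (v 0)] (a : M) :
    ∃ b, ∀ x, E x b ↔ E x a ∧ P x := by
  obtain ⟨φ, hφ⟩ := hP.out
  obtain ⟨k, p, ψ, hψ⟩ := exists_formula (E := E) φ a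
  -- The second distinguished variable is irrelevant here; its slot is filled with `a`.
  obtain ⟨b, hb⟩ := hM.out.separation (k + 1) ψ (Fin.cons a p) a
  refine ⟨b, fun x => ?_⟩
  rw [hb, ← hψ, ← hφ]
  rfl

theorem exists_repl (R : M → M → Prop) [hR : Dfn E fun v => R (v 0) (v 1)] (a : M)
    (h : ∀ x, E x a → ∃! y, R x y) : ∃ b, ∀ y, E y b ↔ ∃ x, E x a ∧ R x y := by
  obtain ⟨φ, hφ⟩ := hR.out
  obtain ⟨k, p, ψ, hψ⟩ := exists_formula (E := E) φ a
  have key : ∀ x y, R x y ↔ Sat E ψ (Fin.cons x (Fin.cons y p : Fin (k + 1) → M)) := by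
    intro x y
    rw [← hψ, ← hφ]
    rfl
  simp only [key] at h ⊢
  exact hM.out.replacement k ψ p a h

theorem set_ext {a b : M} (h : ∀ x, E x a ↔ E x b) : a = b := hM.out.extensionality a b h

theorem exists_pair (a b : M) : ∃ p, IsPair E p a b := by
  obtain ⟨u, hu⟩ := hM.out.pairing a a
  obtain ⟨v, hv⟩ := hM.out.pairing a b
  obtain ⟨p, hp⟩ := hM.out.pairing u v
  exact ⟨p, u, v, by simpa using hu, hv, hp⟩

theorem IsPair.unique {p q a b : M} (hp : IsPair E p a b) (hq : IsPair E q a b) : p = q := by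
  obtain ⟨u, v, hu, hv, hp⟩ := hp
  obtain ⟨u', v', hu', hv', hq⟩ := hq
  obtain rfl : u = u' := set_ext (E := E) fun x => by rw [hu, hu']
  obtain rfl : v = v' := set_ext (E := E) fun x => by rw [hv, hv']
  exact set_ext (E := E) fun x => by rw [hp, hq]

theorem maps_iff {f a b p : M} (hp : IsPair E p a b) : Maps E f a b ↔ E p f :=
  ⟨fun ⟨_, hq, h⟩ => hq.unique hp ▸ h, fun h => ⟨p, hp, h⟩⟩

theorem exists_isEmptySet : ∃ e, IsEmptySet E e := by
  obtain ⟨_, ⟨e, he, _⟩, _⟩ := hM.out.infinity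
  exact ⟨e, he⟩

theorem exists_isSucc (x : M) : ∃ s, IsSucc E s x := by
  obtain ⟨u, hu⟩ := hM.out.pairing x x
  obtain ⟨v, hv⟩ := hM.out.pairing x u
  obtain ⟨s, hs⟩ := hM.out.union v
  refine ⟨s, fun y => ?_⟩
  simp only [hs, hv]
  constructor
  · rintro ⟨z, rfl | rfl, h⟩
    · exact Or.inl h
    · exact Or.inr (by simpa using (hu y).1 h)
  · rintro (h | rfl)
    · exact ⟨x, Or.inl rfl, h⟩
    · exact ⟨u, Or.inr rfl, (hu y).2 (Or.inl rfl)⟩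

variable (E) in
/-- The empty set of the model. -/
noncomputable def zero : M := (exists_isEmptySet (E := E)).choose

variable (E) in
/-- `x ∪ {x}`. -/
noncomputable def succ (x : M) : M := (exists_isSucc (E := E) x).choose

theorem not_mem_zero (x : M) : ¬ E x (zero E) := (exists_isEmptySet (E := E)).choose_spec x

theorem mem_succ {x y : M} : E y (succ E x) ↔ E y x ∨ y = x :=
  (exists_isSucc (E := E) x).choose_spec y

theorem isEmptySet_iff {x : M} : IsEmptySet E x ↔ x = zero E :=
  ⟨fun h => set_ext (E := E) fun y => iff_of_false (h y) (not_mem_zero y),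
    fun h => h ▸ not_mem_zero⟩

theorem isSucc_iff {s x : M} : IsSucc E s x ↔ s = succ E x :=
  ⟨fun h => set_ext (E := E) fun y => by rw [h, mem_succ (E := E)], fun h => h ▸ fun _ => mem_succ⟩

theorem isInductive_iff {a : M} :
    IsInductive E a ↔ E (zero E) a ∧ ∀ x, E x a → E (succ E x) a := by
  simp [IsInductive, isEmptySet_iff, isSucc_iff]

theorem exists_omega : ∃ w, IsOmega E w := by
  obtain ⟨a, ha⟩ := hM.out.infinity
  obtain ⟨w, hw⟩ := exists_sep (E := E) (fun x => IsNat E x) a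
  exact ⟨w, fun n => by rw [hw]; exact ⟨fun h => h.2, fun h => ⟨h a ha, h⟩⟩⟩

theorem isNat_zero : IsNat E (zero E) := fun _ ha => (isInductive_iff.1 ha).1

theorem IsNat.succ {n : M} (hn : IsNat E n) : IsNat E (succ E n) :=
  fun a ha => (isInductive_iff.1 ha).2 n (hn a ha)

theorem nat_induction (P : M → Prop) [Dfn E fun v => P (v 0)] (h0 : P (zero E))
    (hs : ∀ n, IsNat E n → P n → P (succ E n)) {n : M} (hn : IsNat E n) : P n := by
  obtain ⟨w, hw⟩ := exists_omega (E := E)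
  obtain ⟨b, hb⟩ := exists_sep (E := E) P w
  refine ((hb n).1 (hn b (isInductive_iff.2 ⟨(hb _).2 ⟨(hw _).2 isNat_zero, h0⟩, ?_⟩))).2
  intro x hx
  rw [hb, hw] at hx ⊢
  exact ⟨hx.1.succ, hs x hx.1 hx.2⟩

theorem IsNat.mem {m n : M} (hn : IsNat E n) (h : E m n) : IsNat E m := by
  refine nat_induction (E := E) (fun n => ∀ m, E m n → IsNat E m) ?_ ?_ hn m h
  · exact fun m hm => (not_mem_zero m hm).elim
  · intro n hn ih m hm
    rcases mem_succ.1 hm with h | rfl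
    · exact ih m h
    · exact hn

theorem mem_irrefl (x : M) : ¬ E x x := by
  intro h
  obtain ⟨u, hu⟩ := hM.out.pairing x x
  obtain ⟨y, hy, hy'⟩ := hM.out.foundation u ⟨x, (hu x).2 (Or.inl rfl)⟩
  obtain rfl : y = x := by simpa using (hu y).1 hy
  exact hy' y h hy

theorem mem_trans {a b n : M} (hab : E a b) (hbn : E b n) (hn : IsNat E n) : E a n := by
  refine nat_induction (E := E) (fun n => ∀ b, E b n → ∀ a, E a b → E a n) ?_ ?_ hn b hbn a hab
  · exact fun m hm => (not_mem_zero m hm).elim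
  · intro n hn ih b hb a hab
    rw [mem_succ (E := E)] at hb ⊢
    rcases hb with h | rfl
    · exact Or.inl (ih b h a hab)
    · exact Or.inl hab

theorem succ_le {m n : M} (hn : IsNat E n) (h : E m n) : E (succ E m) n ∨ succ E m = n := by
  refine nat_induction (E := E)
    (fun n => ∀ m, E m n → ∀ s, IsSucc E s m → E s n ∨ s = n) ?_ ?_ hn m h _ (isSucc_iff.2 rfl)
  · exact fun m hm => (not_mem_zero m hm).elim
  · intro n hn ih m hm s hs
    rw [mem_succ (E := E)] at hm ⊢
    rcases hm with h | rfl
    · exact Or.inl (ih m h s hs)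
    · exact Or.inr (isSucc_iff.1 hs)

theorem mem_trichotomy {m n : M} (hm : IsNat E m) (hn : IsNat E n) :
    E m n ∨ m = n ∨ E n m := by
  have h0 : ∀ m, IsNat E m → zero E = m ∨ E (zero E) m := fun m hm => by
    refine nat_induction (E := E) (fun m => zero E = m ∨ E (zero E) m) (Or.inl rfl) ?_ hm
    rintro n hn (h | h)
    · exact Or.inr (mem_succ.2 (Or.inr h))
    · exact Or.inr (mem_succ.2 (Or.inl h))
  refine nat_induction (E := E)
    (fun n => ∀ m, IsNat E m → E m n ∨ m = n ∨ E n m) ?_ ?_ hn m hm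
  · intro m hm
    rcases h0 m hm with h | h
    · exact Or.inr (Or.inl h.symm)
    · exact Or.inr (Or.inr h)
  · intro n hn ih m hm
    rcases ih m hm with h | rfl | h
    · exact Or.inl (mem_succ.2 (Or.inl h))
    · exact Or.inl (mem_succ.2 (Or.inr rfl))
    · rcases succ_le hm h with h | h
      · exact Or.inr (Or.inr h)
      · exact Or.inr (Or.inl h.symm)

theorem nat_strong_induction (P : M → Prop) [Dfn E fun v => P (v 0)]
    (h : ∀ n, IsNat E n → (∀ m, E m n → P m) → P n) {n : M} (hn : IsNat E n) : P n := by
  by_contra hP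
  obtain ⟨w, hw⟩ := exists_omega (E := E)
  obtain ⟨b, hb⟩ := exists_sep (E := E) (fun x => ¬ P x) w
  obtain ⟨y, hy, hy'⟩ := hM.out.foundation b ⟨n, (hb n).2 ⟨(hw n).2 hn, hP⟩⟩
  rw [hb, hw] at hy
  refine hy.2 (h y hy.1 fun m hm => ?_)
  by_contra hPm
  exact hy' m hm ((hb m).2 ⟨(hw m).2 (hy.1.mem hm), hPm⟩)

/-- Every definable nonempty class of natural numbers has a least element. -/
theorem exists_least (P : M → Prop) [Dfn E fun v => P (v 0)] {n : M} (hn : IsNat E n)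
    (h : P n) : ∃ m, IsNat E m ∧ P m ∧ ∀ k, IsNat E k → P k → m = k ∨ E m k := by
  by_contra! H
  refine nat_strong_induction (E := E) (fun x => ¬ P x) (fun x hx ih hPx => ?_) hn h
  obtain ⟨k, hk, hPk, h1, h2⟩ := H x hx hPx
  rcases mem_trichotomy hx hk with h | h | h
  exacts [h2 h, h1 h, ih k h hPk]

variable (E) in
/-- The type of natural numbers of the model. -/
def Nt : Type u := {n : M // IsNat E n}

/-- With membership as a linear order, the combinatorics of blocks can be carried out in arbitrary
linear orders. -/
noncomputable instance : LinearOrder (Nt E) where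
  lt m n := E m.1 n.1
  le m n := m = n ∨ E m.1 n.1
  le_refl m := Or.inl rfl
  le_trans a b c := by
    rintro (rfl | h) (rfl | h')
    exacts [Or.inl rfl, Or.inr h', Or.inr h, Or.inr (mem_trans h h' c.2)]
  le_antisymm a b := by
    rintro (rfl | h) (h' | h')
    exacts [rfl, rfl, h'.symm, (mem_irrefl _ (mem_trans h h' a.2)).elim]
  lt_iff_le_not_ge a b := by
    constructor
    · refine fun h => ⟨Or.inr h, ?_⟩
      rintro (rfl | h')
      exacts [mem_irrefl _ h, mem_irrefl _ (mem_trans h h' a.2)]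
    · rintro ⟨rfl | h, h'⟩
      exacts [(h' (Or.inl rfl)).elim, h]
  le_total a b := by
    rcases mem_trichotomy a.2 b.2 with h | h | h
    exacts [Or.inl (Or.inr h), Or.inl (Or.inl (Subtype.ext h)), Or.inr (Or.inr h)]
  toDecidableLE := Classical.decRel _

end Basic

/-! ### Functions and recursion on the natural numbers -/

section Recursion

variable {M : Type u} {E : M → M → Prop}

/-- When `R` is a variable, instance search cannot unfold it. Substituting terms into a defining
formula supplies the local instances needed to use `R` under further quantifiers. -/
theorem Dfn.subst₃ {R : M → M → M → Prop} (hR : Dfn E fun v => R (v 0) (v 1) (v 2))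
    (s t r : (ℕ → M) → M) [hs : DfnTerm s] [ht : DfnTerm t] [hr : DfnTerm r] :
    Dfn E fun v => R (s v) (t v) (r v) := by
  obtain ⟨x, hx⟩ := hs.out
  obtain ⟨y, hy⟩ := ht.out
  obtain ⟨z, hz⟩ := hr.out
  obtain ⟨φ, hφ⟩ := hR.out
  refine ⟨φ.relabel fun a => match a with
    | Sum.inl c => Sum.inl c
    | Sum.inr 0 => x
    | Sum.inr 1 => y
    | Sum.inr 2 => z
    | Sum.inr (i + 3) => Sum.inr i, fun v => ?_⟩
  let _ := setStructure E
  refine (hφ (bind (s v) (bind (t v) (bind (r v) v)))).trans ?_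
  rw [Holds, Holds, FirstOrder.Language.Formula.realize_relabel]
  refine iff_of_eq (congrArg _ (funext fun a => ?_))
  rcases a with c | _ | _ | _ | i
  · rfl
  · exact hx v
  · exact hy v
  · exact hz v
  · rfl

theorem Dfn.subst₂ {R : M → M → Prop} (hR : Dfn E fun v => R (v 0) (v 1)) (s t : (ℕ → M) → M)
    [DfnTerm s] [DfnTerm t] : Dfn E fun v => R (s v) (t v) :=
  Dfn.subst₃ (R := fun x y _ => R x y) hR s t s

theorem Dfn.subst₁ {P : M → Prop} (hP : Dfn E fun v => P (v 0)) (s : (ℕ → M) → M)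
    [DfnTerm s] : Dfn E fun v => P (s v) :=
  Dfn.subst₂ (R := fun x _ => P x) hP s s

variable [hM : Fact (IsModelZF E)]

theorem exists_adjoin (a q : M) : ∃ b, ∀ p, E p b ↔ E p a ∨ p = q := by
  obtain ⟨u, hu⟩ := hM.out.pairing q q
  obtain ⟨v, hv⟩ := hM.out.pairing a u
  obtain ⟨b, hb⟩ := hM.out.union v
  refine ⟨b, fun y => ?_⟩
  simp only [hb, hv]
  constructor
  · rintro ⟨z, rfl | rfl, h⟩
    · exact Or.inl h
    · exact Or.inr (by simpa using (hu y).1 h)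
  · rintro (h | rfl)
    · exact ⟨a, Or.inl rfl, h⟩
    · exact ⟨u, Or.inr rfl, (hu y).2 (Or.inl rfl)⟩

theorem maps_of_adjoin {f g a b : M} (h : ∀ p, E p g ↔ E p f ∨ IsPair E p a b) (m s : M) :
    Maps E g m s ↔ Maps E f m s ∨ m = a ∧ s = b := by
  obtain ⟨q, hq⟩ := exists_pair (E := E) m s
  rw [maps_iff hq, maps_iff hq, h]
  refine or_congr_right ⟨fun hq' => hq.inj hq', ?_⟩
  rintro ⟨rfl, rfl⟩
  exact hq

theorem exists_adjoin_pair (f a b : M) : ∃ g, ∀ p, E p g ↔ E p f ∨ IsPair E p a b := by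
  obtain ⟨q, hq⟩ := exists_pair (E := E) a b
  obtain ⟨g, hg⟩ := exists_adjoin (E := E) f q
  refine ⟨g, fun p => (hg p).trans (or_congr_right ⟨?_, fun h => h.unique hq⟩)⟩
  rintro rfl
  exact hq

/-- A definable functional relation on a set is given by a function of the model. -/
theorem exists_function (R : M → M → Prop) [hR : Dfn E fun v => R (v 0) (v 1)] (a : M)
    (h : ∀ n, E n a → ∃! k, R n k) :
    ∃ f, (∀ p, E p f → ∃ n k, E n a ∧ R n k ∧ IsPair E p n k) ∧
      ∀ n k, Maps E f n k ↔ E n a ∧ R n k := by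
  have := fun s t [DfnTerm s] [DfnTerm t] => hR.subst₂ s t
  obtain ⟨f, hf⟩ := exists_repl (E := E) (fun n p => ∃ k, R n k ∧ IsPair E p n k) a fun n hn => by
    obtain ⟨k, hk, hk'⟩ := h n hn
    obtain ⟨p, hp⟩ := exists_pair (E := E) n k
    refine ⟨p, ⟨k, hk, hp⟩, ?_⟩
    rintro q ⟨l, hl, hq⟩
    obtain rfl := hk' l hl
    exact hq.unique hp
  refine ⟨f, fun p hp => ?_, fun n k => ?_⟩
  · obtain ⟨n, hn, k, hk, hp⟩ := (hf p).1 hp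
    exact ⟨n, k, hn, hk, hp⟩
  · obtain ⟨p, hp⟩ := exists_pair (E := E) n k
    rw [maps_iff hp, hf]
    constructor
    · rintro ⟨m, hm, l, hl, hq⟩
      obtain ⟨rfl, rfl⟩ := hp.inj hq
      exact ⟨hm, hl⟩
    · exact fun ⟨hn, hk⟩ => ⟨n, hn, k, hk, hp⟩

theorem succ_ne_zero (n : M) : succ E n ≠ zero E := fun h =>
  not_mem_zero n (h ▸ mem_succ.2 (Or.inr rfl))

theorem mem_succ_self (n : M) : E n (succ E n) := mem_succ.2 (Or.inr rfl)

theorem succ_inj {m n : M} (hm : IsNat E m) (h : succ E m = succ E n) : m = n := by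
  have h1 := mem_succ.1 (h ▸ mem_succ_self (E := E) m)
  have h2 := mem_succ.1 (h.symm ▸ mem_succ_self (E := E) n)
  rcases h1 with h1 | rfl
  · rcases h2 with h2 | rfl
    · exact (mem_irrefl _ (mem_trans h1 h2 hm)).elim
    · rfl
  · rfl

/-- Definable recursion along the natural numbers. -/
theorem exists_rec (G : M → M → M → Prop) [hG : Dfn E fun v => G (v 0) (v 1) (v 2)]
    (X : M → Prop) [hX : Dfn E fun v => X (v 0)] (a₀ : M) (h₀ : X a₀)
    (hfun : ∀ n s, IsNat E n → X s → ∃! t, G n s t)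
    (hXG : ∀ n s t, X s → G n s t → X t) :
    ∃ F, (∀ n, IsNat E n → ∃! s, Maps E F n s) ∧ (∀ n s, IsNat E n → Maps E F n s → X s) ∧
      Maps E F (zero E) a₀ ∧
      ∀ n s t, IsNat E n → Maps E F n s → Maps E F (succ E n) t → G n s t := by
  have := fun s t r [DfnTerm s] [DfnTerm t] [DfnTerm r] => hG.subst₃ s t r
  have := fun s [DfnTerm s] => hX.subst₁ s
  -- `approx f n` says that the pairs in `f` are exactly those of the recursion up to and including
  -- `n`. Only the pairs in `f` matter, so `f` itself need not be unique.
  let next : M → M → M → Prop := fun f m s =>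
    (m = zero E ∧ s = a₀) ∨ ∃ k t, IsSucc E m k ∧ Maps E f k t ∧ G k t s
  let approx : M → M → Prop := fun f n =>
    ∀ m s, Maps E f m s ↔ (E m n ∨ m = n) ∧ next f m s
  have next_zero : ∀ f s, next f (zero E) s ↔ s = a₀ := by
    intro f s
    constructor
    · rintro (h | ⟨k, t, hk, -⟩)
      · exact h.2
      · exact (succ_ne_zero k (isSucc_iff.1 hk).symm).elim
    · exact fun h => Or.inl ⟨rfl, h⟩
  have next_succ : ∀ f n s, IsNat E n → (next f (succ E n) s ↔ ∃ t, Maps E f n t ∧ G n t s) := by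
    intro f n s hn
    constructor
    · rintro (h | ⟨k, t, hk, h⟩)
      · exact (succ_ne_zero n h.1).elim
      · obtain rfl := succ_inj hn (isSucc_iff.1 hk)
        exact ⟨t, h⟩
    · exact fun ⟨t, h⟩ => Or.inr ⟨n, t, isSucc_iff.2 rfl, h⟩
  have agree : ∀ f g n n', IsNat E n → IsNat E n' → approx f n → approx g n' → ∀ m, IsNat E m →
      (E m n ∨ m = n) → (E m n' ∨ m = n') → ∀ s, Maps E f m s ↔ Maps E g m s := by
    intro f g n n' hn hn' hf hg m hm
    refine nat_induction (E := E) (fun m => (E m n ∨ m = n) → (E m n' ∨ m = n') →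
      ∀ s, Maps E f m s ↔ Maps E g m s) ?_ ?_ hm
    · intro h h' s
      rw [hf, hg, next_zero, next_zero, and_iff_right h, and_iff_right h']
    · intro m hm ih h h' s
      have e : ∀ n, IsNat E n → (E (succ E m) n ∨ succ E m = n) → E m n := by
        rintro n hn (h | rfl)
        · exact mem_trans (mem_succ_self m) h hn
        · exact mem_succ_self m
      rw [hf, hg, next_succ _ _ _ hm, next_succ _ _ _ hm, and_iff_right h, and_iff_right h']
      simp only [ih (Or.inl (e n hn h)) (Or.inl (e n' hn' h'))]
  have exist : ∀ n, IsNat E n → ∃ f s, approx f n ∧ Maps E f n s ∧ X s ∧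
      ∀ t, Maps E f n t → t = s := by
    intro n hn
    refine nat_induction (E := E) (fun n => ∃ f s, approx f n ∧ Maps E f n s ∧ X s ∧
      ∀ t, Maps E f n t → t = s) ?_ ?_ hn
    · obtain ⟨f, hf⟩ := exists_adjoin_pair (E := E) (zero E) (zero E) a₀
      have hf' := maps_of_adjoin hf
      have hz : ∀ m s, ¬ Maps E (zero E) m s := fun m s ⟨p, _, hp⟩ => not_mem_zero p hp
      simp only [hz, false_or] at hf'
      refine ⟨f, a₀, fun m s => ?_, (hf' _ _).2 ⟨rfl, rfl⟩, h₀, fun t ht => ((hf' _ _).1 ht).2⟩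
      rw [hf']
      constructor
      · rintro ⟨rfl, rfl⟩
        exact ⟨Or.inr rfl, (next_zero _ _).2 rfl⟩
      · rintro ⟨h | rfl, h'⟩
        · exact (not_mem_zero _ h).elim
        · exact ⟨rfl, (next_zero _ _).1 h'⟩
    · rintro n hn ⟨f, s, hf, hs, hXs, hs'⟩
      obtain ⟨t, ht, ht'⟩ := hfun n s hn hXs
      obtain ⟨g, hg⟩ := exists_adjoin_pair (E := E) f (succ E n) t
      have hg' := maps_of_adjoin hg
      have hdom : ∀ s, ¬ Maps E f (succ E n) s := by
        intro s h
        rcases ((hf _ _).1 h).1 with h | h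
        · exact mem_irrefl _ (mem_trans h (mem_succ_self n) hn.succ)
        · exact mem_irrefl (E := E) n (by simpa only [h] using mem_succ_self (E := E) n)
      have hfg : ∀ m, (E m n ∨ m = n) → ∀ s, Maps E g m s ↔ Maps E f m s := by
        intro m hm s
        rw [hg']
        refine or_iff_left ?_
        rintro ⟨rfl, -⟩
        rcases hm with h | h
        · exact mem_irrefl _ (mem_trans h (mem_succ_self n) hn.succ)
        · exact mem_irrefl (E := E) n (by simpa only [h] using mem_succ_self (E := E) n)
      have hnext : ∀ m, (E m n ∨ m = n) → ∀ s, next g m s ↔ next f m s := by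
        intro m hm s
        refine or_congr_right (exists_congr fun k => exists_congr fun u => and_congr_right
          fun hk => and_congr_left fun _ => hfg k (Or.inl ?_) u)
        obtain rfl := isSucc_iff.1 hk
        rcases hm with hm | rfl
        · exact mem_trans (mem_succ_self k) hm hn
        · exact mem_succ_self k
      have hgt : Maps E g (succ E n) t := (hg' _ _).2 (Or.inr ⟨rfl, rfl⟩)
      refine ⟨g, t, fun m u => ?_, hgt, hXG n s t hXs ht, fun u hu => ?_⟩
      · constructor
        · intro h
          rcases (hg' _ _).1 h with h | ⟨rfl, rfl⟩
          · have := (hf _ _).1 h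
            exact ⟨Or.inl (mem_succ.2 this.1), (hnext m this.1 u).2 this.2⟩
          · exact ⟨Or.inr rfl, (next_succ _ _ _ hn).2 ⟨s, (hfg n (Or.inr rfl) s).2 hs, ht⟩⟩
        · rintro ⟨hm, h⟩
          rcases hm with hm | rfl
          · have hm' := mem_succ.1 hm
            rw [hfg m hm', hf]
            exact ⟨hm', (hnext m hm' u).1 h⟩
          · obtain ⟨s', h1, h2⟩ := (next_succ _ _ _ hn).1 h
            obtain rfl := hs' s' ((hfg n (Or.inr rfl) s').1 h1)
            obtain rfl := ht' u h2
            exact hgt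
      · rcases (hg' _ _).1 hu with h | h
        · exact (hdom u h).elim
        · exact h.2
  obtain ⟨w, hw⟩ := exists_omega (E := E)
  -- Approximations agree on their common domain, so their values at the last argument define a
  -- single function on `ω`.
  obtain ⟨F, -, hF⟩ := exists_function (E := E) (fun n s => ∃ f, approx f n ∧ Maps E f n s) w
    fun n hn => by
      obtain ⟨f, s, hf, hs, -, hs'⟩ := exist n ((hw n).1 hn)
      refine ⟨s, ⟨f, hf, hs⟩, ?_⟩
      rintro t ⟨g, hg, ht⟩
      have hn := (hw n).1 hn
      exact hs' t ((agree f g n n hn hn hf hg n hn (Or.inr rfl) (Or.inr rfl) t).2 ht)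
  have key : ∀ n f, IsNat E n → approx f n → ∀ s, Maps E F n s ↔ Maps E f n s := by
    intro n f hn hf s
    rw [hF, and_iff_right ((hw n).2 hn)]
    constructor
    · rintro ⟨g, hg, ht⟩
      exact (agree f g n n hn hn hf hg n hn (Or.inr rfl) (Or.inr rfl) s).2 ht
    · exact fun h => ⟨f, hf, h⟩
  refine ⟨F, fun n hn => ?_, fun n s hn hs => ?_, ?_, fun n s t hn hs ht => ?_⟩
  · obtain ⟨f, s, hf, hs, -, hs'⟩ := exist n hn
    exact ⟨s, (key n f hn hf s).2 hs, fun t ht => hs' t ((key n f hn hf t).1 ht)⟩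
  · obtain ⟨f, t, hf, ht, hX, ht'⟩ := exist n hn
    rw [ht' s ((key n f hn hf s).1 hs)]
    exact hX
  · obtain ⟨f, s, hf, -⟩ := exist _ (isNat_zero (E := E))
    rw [key _ f isNat_zero hf, hf, next_zero]
    exact ⟨Or.inr rfl, rfl⟩
  · obtain ⟨f, -, hf, -⟩ := exist n hn
    obtain ⟨g, -, hg, -⟩ := exist _ hn.succ
    rw [key _ g hn.succ hg, hg, next_succ _ _ _ hn] at ht
    obtain ⟨s', h1, h2⟩ := ht.2
    rw [← agree f g n _ hn hn.succ hf hg n hn (Or.inr rfl) (Or.inl (mem_succ_self n)),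
      ← key n f hn hf] at h1
    have hFn : ∃! s, Maps E F n s := by
      obtain ⟨f, s, hf, hs, -, hs'⟩ := exist n hn
      exact ⟨s, (key n f hn hf s).2 hs, fun t ht => hs' t ((key n f hn hf t).1 ht)⟩
    obtain rfl := hFn.unique h1 hs
    exact h2

end Recursion

/-! ### Increasing sequences -/

section Increasing

variable {M : Type u} {E : M → M → Prop}

variable (E) in
/-- `j` is a value of the function `f`. -/
def InRange (f j : M) : Prop := ∃ n, Maps E f n j

instance (s t : (ℕ → M) → M) [DfnTerm s] [DfnTerm t] :
    Dfn E (fun v => InRange E (s v) (t v)) := by unfold InRange; infer_instance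

variable (E) in
/-- `d` is an initial segment of `ω`. -/
structure IsNatInitial (d : M) : Prop where
  isNat : ∀ n, E n d → IsNat E n
  trans : ∀ m n, E m n → E n d → E m d

theorem IsIncreasingOn.of_maps {d f n k : M} (hf : IsIncreasingOn E d f) (h : Maps E f n k) :
    E n d ∧ IsNat E k := by
  obtain ⟨p, hp, hpf⟩ := h
  obtain ⟨n', k', hn, hk, hp'⟩ := hf.1 p hpf
  obtain ⟨rfl, rfl⟩ := hp.inj hp'
  exact ⟨hn, hk⟩

theorem IsIncreasingOn.functional {d f n k l : M} (hf : IsIncreasingOn E d f)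
    (h : Maps E f n k) (h' : Maps E f n l) : k = l :=
  (hf.2.1 n (hf.of_maps h).1).unique h h'

theorem IsIncreasingOn.isNat_of_inRange {d f j : M} (hf : IsIncreasingOn E d f)
    (h : InRange E f j) : IsNat E j := (hf.of_maps h.choose_spec).2

theorem IsReal.isNat_of_maps {x n k : M} (hx : IsReal E x) (h : Maps E x n k) :
    IsNat E n ∧ IsNat E k := by
  obtain ⟨w, hw, hx⟩ := hx
  exact ⟨(hw n).1 (hx.of_maps h).1, (hx.of_maps h).2⟩

theorem IsReal.isNat_of_inRange {x k : M} (hx : IsReal E x) (h : InRange E x k) : IsNat E k :=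
  (hx.isNat_of_maps h.choose_spec).2

variable [hM : Fact (IsModelZF E)]

theorem isNatInitial_of_isOmega {w : M} (hw : IsOmega E w) : IsNatInitial E w :=
  ⟨fun n hn => (hw n).1 hn, fun m n h hn => (hw m).2 (((hw n).1 hn).mem h)⟩

theorem isNatInitial_of_isNat {d : M} (hd : IsNat E d) : IsNatInitial E d :=
  ⟨fun _ hn => hd.mem hn, fun _ _ h hn => mem_trans h hn hd⟩

namespace IsIncreasingOn

theorem lt_of_lt {d f m n a b : M} (hf : IsIncreasingOn E d f) (hd : IsNatInitial E d)
    (hm : Maps E f m a) (hn : Maps E f n b) (h : E a b) : E m n := by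
  have hb := (hf.of_maps hn).2
  rcases mem_trichotomy (hd.isNat m (hf.of_maps hm).1) (hd.isNat n (hf.of_maps hn).1) with
    h' | rfl | h'
  · exact h'
  · obtain rfl := hf.functional hm hn
    exact (mem_irrefl _ h).elim
  · exact (mem_irrefl _ (mem_trans h (hf.2.2 n m b a h' hn hm) (hf.of_maps hm).2)).elim

theorem injective {d f m n a : M} (hf : IsIncreasingOn E d f) (hd : IsNatInitial E d)
    (hm : Maps E f m a) (hn : Maps E f n a) : m = n := by
  rcases mem_trichotomy (hd.isNat m (hf.of_maps hm).1) (hd.isNat n (hf.of_maps hn).1) with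
    h' | rfl | h'
  · exact (mem_irrefl _ (hf.2.2 _ _ _ _ h' hm hn)).elim
  · rfl
  · exact (mem_irrefl _ (hf.2.2 _ _ _ _ h' hn hm)).elim

theorem subset_of_maps {d f g : M} (hf : IsIncreasingOn E d f)
    (h : ∀ n k, Maps E f n k → Maps E g n k) : IsSubset E f g := by
  intro p hp
  obtain ⟨n, k, -, -, hpair⟩ := hf.1 p hp
  exact (maps_iff hpair).1 (h n k ((maps_iff hpair).2 hp))

/-- Strong induction on the position `n` of a value `a` in `f`. Were `a` earlier in `g`, the
induction hypothesis would make `f` repeat it; were `a` later in `g`, the value of `g` at `n` would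
be a smaller value of `f`, at an earlier position, and `g` would repeat that one. `IsNatInitial`
covers finite sequences and reals at once. -/
theorem maps_of_range_eq {d d' f g : M} (hf : IsIncreasingOn E d f) (hd : IsNatInitial E d)
    (hg : IsIncreasingOn E d' g) (hd' : IsNatInitial E d')
    (h : ∀ j, InRange E f j ↔ InRange E g j) {n a : M} (hn : Maps E f n a) : Maps E g n a := by
  refine nat_strong_induction (E := E)
    (fun n => E n d → ∀ a, Maps E f n a → Maps E g n a) ?_ (hd.isNat n (hf.of_maps hn).1)
    (hf.of_maps hn).1 a hn
  intro n hn ih hnd a ha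
  obtain ⟨m, hm⟩ := (h a).1 ⟨n, ha⟩
  rcases mem_trichotomy (hd'.isNat m (hg.of_maps hm).1) hn with hmn | rfl | hmn
  · obtain ⟨b, hb, -⟩ := hf.2.1 m (hd.trans m n hmn hnd)
    obtain rfl := hg.functional hm (ih m hmn (hf.of_maps hb).1 b hb)
    exact (mem_irrefl _ (hf.2.2 _ _ _ _ hmn hb ha)).elim
  · exact hm
  · obtain ⟨b, hb, -⟩ := hg.2.1 n (hd'.trans n m hmn (hg.of_maps hm).1)
    obtain ⟨i, hi⟩ := (h b).2 ⟨n, hb⟩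
    have hin := hf.lt_of_lt hd hi ha (hg.2.2 _ _ _ _ hmn hb hm)
    obtain rfl := hg.injective hd' (ih i hin (hf.of_maps hi).1 b hi) hb
    exact (mem_irrefl _ hin).elim

theorem eq_of_range_eq {d d' f g : M} (hf : IsIncreasingOn E d f) (hd : IsNatInitial E d)
    (hg : IsIncreasingOn E d' g) (hd' : IsNatInitial E d')
    (h : ∀ j, InRange E f j ↔ InRange E g j) : f = g :=
  set_ext (E := E) fun p =>
    ⟨subset_of_maps hf (fun _ _ => hf.maps_of_range_eq hd hg hd' h) p,
      subset_of_maps hg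
        (fun _ _ => hg.maps_of_range_eq hd' hf hd fun j => (h j).symm) p⟩

end IsIncreasingOn

theorem isReal_iff {x : M} : IsReal E x ↔
    (∀ p, E p x → ∃ n k, IsNat E n ∧ IsNat E k ∧ IsPair E p n k) ∧
    (∀ n, IsNat E n → ∃! k, Maps E x n k) ∧
    ∀ m n a b, E m n → Maps E x m a → Maps E x n b → E a b := by
  constructor
  · rintro ⟨w, hw, h⟩
    simpa only [IsIncreasingOn, hw _] using h
  · intro h
    obtain ⟨w, hw⟩ := exists_omega (E := E)
    refine ⟨w, hw, ?_⟩
    simpa only [IsIncreasingOn, hw _] using h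

namespace IsReal

variable {x y n k l a : M}

theorem exists_maps (hx : IsReal E x) (hn : IsNat E n) : ∃ k, Maps E x n k :=
  ((isReal_iff.1 hx).2.1 n hn).exists

theorem functional (hx : IsReal E x) (h : Maps E x n k) (h' : Maps E x n l) : k = l :=
  ((isReal_iff.1 hx).2.1 n (hx.isNat_of_maps h).1).unique h h'

theorem lt {m b : M} (hx : IsReal E x) (h : E m n) (hm : Maps E x m a) (hn : Maps E x n b) :
    E a b := (isReal_iff.1 hx).2.2 m n a b h hm hn

theorem injective {m : M} (hx : IsReal E x) (hm : Maps E x m a) (hn : Maps E x n a) : m = n := by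
  obtain ⟨w, hw, hx⟩ := hx
  exact hx.injective (isNatInitial_of_isOmega hw) hm hn

theorem eq_of_range_eq (hx : IsReal E x) (hy : IsReal E y)
    (h : ∀ j, InRange E x j ↔ InRange E y j) : x = y := by
  obtain ⟨w, hw, hx⟩ := hx
  obtain ⟨w', hw', hy⟩ := hy
  exact hx.eq_of_range_eq (isNatInitial_of_isOmega hw) hy (isNatInitial_of_isOmega hw') h

theorem le_value (hx : IsReal E x) (h : Maps E x n a) : n = a ∨ E n a := by
  refine nat_induction (E := E) (fun n => ∀ a, Maps E x n a → n = a ∨ E n a) ?_ ?_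
    (hx.isNat_of_maps h).1 a h
  · intro a ha
    rcases mem_trichotomy (isNat_zero (E := E)) (hx.isNat_of_maps ha).2 with h | h | h
    exacts [Or.inr h, Or.inl h, (not_mem_zero _ h).elim]
  · intro n hn ih b hb
    obtain ⟨a, ha⟩ := hx.exists_maps hn
    have hab := hx.lt (mem_succ_self n) ha hb
    have hbn := (hx.isNat_of_maps hb).2
    rcases ih a ha with rfl | h
    · exact (succ_le hbn hab).symm
    · exact (succ_le hbn (mem_trans h hab hbn)).symm

end IsReal

/-- A definable sequence of natural numbers that increases at each step is a real. -/
theorem exists_isReal_of_step (R : M → M → Prop) [hR : Dfn E fun v => R (v 0) (v 1)]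
    (hfun : ∀ n, IsNat E n → ∃! k, R n k) (hnat : ∀ n k, IsNat E n → R n k → IsNat E k)
    (hstep : ∀ n a b, IsNat E n → R n a → R (succ E n) b → E a b) :
    ∃ x, IsReal E x ∧ ∀ n k, Maps E x n k ↔ IsNat E n ∧ R n k := by
  obtain ⟨w, hw⟩ := exists_omega (E := E)
  obtain ⟨x, hx, hx'⟩ := exists_function (E := E) R w fun n hn => hfun n ((hw n).1 hn)
  simp only [hw _] at hx hx'
  refine ⟨x, isReal_iff.2 ⟨fun p hp => ?_, fun n hn => ?_, ?_⟩, hx'⟩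
  · obtain ⟨n, k, hn, hk, hp⟩ := hx p hp
    exact ⟨n, k, hn, hnat n k hn hk, hp⟩
  · obtain ⟨k, hk, hk'⟩ := hfun n hn
    exact ⟨k, (hx' n k).2 ⟨hn, hk⟩, fun l hl => hk' l ((hx' n l).1 hl).2⟩
  · intro m n a b hmn ha hb
    refine nat_induction (E := E)
      (fun n => ∀ m, E m n → ∀ a b, Maps E x m a → Maps E x n b → E a b) ?_ ?_
      ((hx' n b).1 hb).1 m hmn a b ha hb
    · exact fun m hm => (not_mem_zero m hm).elim
    · intro n hn ih m hm a b ha hb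
      obtain ⟨c, hc, -⟩ := hfun n hn
      rw [hx'] at hb
      have hcb := hstep n c b hn hc hb.2
      rcases mem_succ.1 hm with hm | rfl
      · exact mem_trans (ih m hm a c ha ((hx' n c).2 ⟨hn, hc⟩)) hcb (hnat _ _ hn.succ hb.2)
      · rw [hx'] at ha
        obtain rfl := (hfun m hn).unique ha.2 hc
        exact hcb

/-- An unbounded definable class of natural numbers has an increasing enumeration. -/
theorem exists_enumeration (P : M → Prop) [hP : Dfn E fun v => P (v 0)]
    (hPn : ∀ n, P n → IsNat E n) (hunb : ∀ m, IsNat E m → ∃ k, P k ∧ E m k) :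
    ∃ x, IsReal E x ∧ ∀ j, InRange E x j ↔ P j := by
  have := fun s [DfnTerm s] => hP.subst₁ s
  obtain ⟨a₀, ha₀, hPa₀, hmin⟩ : ∃ m, IsNat E m ∧ P m ∧ ∀ k, IsNat E k → P k → m = k ∨ E m k := by
    obtain ⟨k, hk, -⟩ := hunb _ isNat_zero
    exact exists_least (E := E) P (hPn k hk) hk
  -- `G s t` says that `t` is the next element of `P` after `s`.
  let G : M → M → Prop := fun s t => P t ∧ E s t ∧ ∀ u, P u → E s u → t = u ∨ E t u
  have hfun : ∀ s, P s → ∃! t, G s t := by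
    intro s hs
    obtain ⟨k, hk, hsk⟩ := hunb s (hPn s hs)
    obtain ⟨t, -, ⟨ht, hst⟩, hmin⟩ :=
      exists_least (E := E) (fun t => P t ∧ E s t) (hPn k hk) ⟨hk, hsk⟩
    refine ⟨t, ⟨ht, hst, fun u hu hsu => hmin u (hPn u hu) ⟨hu, hsu⟩⟩, ?_⟩
    rintro t' ⟨ht', hst', hmin'⟩
    rcases hmin t' (hPn t' ht') ⟨ht', hst'⟩ with h | h
    · exact h.symm
    · rcases hmin' t ht hst with h' | h'
      · exact h'
      · exact (mem_irrefl _ (mem_trans h h' (hPn t ht))).elim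
  obtain ⟨F, hF, hFX, hF0, hFs⟩ := exists_rec (E := E) (fun _ => G) P a₀ hPa₀
    (fun _ s _ => hfun s) fun _ s t _ h => h.1
  obtain ⟨x, hx, hx'⟩ := exists_isReal_of_step (E := E) (fun n k => Maps E F n k) hF
    (fun n k hn h => hPn k (hFX n k hn h)) fun n a b hn ha hb => (hFs n a b hn ha hb).2.1
  refine ⟨x, hx, fun j => ⟨?_, fun hj => ?_⟩⟩
  · rintro ⟨n, hn⟩
    rw [hx'] at hn
    exact hFX n j hn.1 hn.2
  · by_contra hjx
    -- An element `j` of `P` that is never listed would bound every value of `x`, contradicting `j ≤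
    -- x(j)`.
    have key : ∀ n, IsNat E n → ∀ a, Maps E x n a → E a j := by
      intro n hn
      refine nat_induction (E := E) (fun n => ∀ a, Maps E x n a → E a j) ?_ ?_ hn
      · intro a ha
        have ha' := ((hx' _ _).1 ha).2
        obtain rfl := (hF _ isNat_zero).unique ha' hF0
        rcases hmin j (hPn j hj) hj with rfl | h
        · exact (hjx ⟨_, ha⟩).elim
        · exact h
      · intro n hn ih b hb
        obtain ⟨a, ha⟩ := hx.exists_maps hn
        have hab := hFs n a b hn ((hx' _ _).1 ha).2 ((hx' _ _).1 hb).2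
        rcases hab.2.2 j hj (ih a ha) with rfl | h
        · exact (hjx ⟨_, hb⟩).elim
        · exact h
    obtain ⟨a, ha⟩ := hx.exists_maps (hPn j hj)
    have h1 := key j (hPn j hj) a ha
    rcases hx.le_value ha with rfl | h
    · exact mem_irrefl _ h1
    · exact mem_irrefl _ (mem_trans h h1 (hPn j hj))

end Increasing

/-! ### Absoluteness between a model and a subuniverse -/

section Absoluteness

variable {M : Type u} {E : M → M → Prop} {W : Set M}

theorem isPair_restrict (hW : ∀ x y, y ∈ W → E x y → x ∈ W) {p a b : W} :
    IsPair (restrict E W) p a b ↔ IsPair E (p : M) a b := by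
  have key : ∀ (u : W) (Q : M → Prop), (∀ x, Q x → x ∈ W) →
      ((∀ x : W, restrict E W x u ↔ Q x) ↔ ∀ x : M, E x u ↔ Q x) := by
    intro u Q hQ
    refine ⟨fun h x => ⟨fun hx => ?_, fun hx => ?_⟩, fun h x => h x⟩
    · exact (h ⟨x, hW x u u.2 hx⟩).1 hx
    · exact (h ⟨x, hQ x hx⟩).2 hx
  have e : ∀ (p u v : W), (∀ x : W, restrict E W x p ↔ x = u ∨ x = v) ↔
      ∀ x : M, E x p ↔ x = u ∨ x = v := by
    intro p u v
    rw [← key p (fun x => x = u ∨ x = v) (by rintro x (rfl | rfl) <;> exact Subtype.prop _)]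
    simp only [Subtype.ext_iff]
  have e' : ∀ (p u : W), (∀ x : W, restrict E W x p ↔ x = u) ↔ ∀ x : M, E x p ↔ x = u := by
    intro p u
    simpa using e p u u
  constructor
  · rintro ⟨u, v, hu, hv, hp⟩
    exact ⟨u, v, (e' u a).1 hu, (e v a b).1 hv, (e p u v).1 hp⟩
  · rintro ⟨u, v, hu, hv, hp⟩
    have huW := hW u p p.2 ((hp u).2 (Or.inl rfl))
    have hvW := hW v p p.2 ((hp v).2 (Or.inr rfl))
    exact ⟨⟨u, huW⟩, ⟨v, hvW⟩, (e' ⟨u, huW⟩ a).2 hu, (e ⟨v, hvW⟩ a b).2 hv,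
      (e p ⟨u, huW⟩ ⟨v, hvW⟩).2 hp⟩

theorem IsPair.mem_of_mem (hW : ∀ x y, y ∈ W → E x y → x ∈ W) {p a b : M} (hp : p ∈ W)
    (h : IsPair E p a b) : a ∈ W ∧ b ∈ W := by
  obtain ⟨u, v, hu, hv, h⟩ := h
  have hvW := hW v p hp ((h v).2 (Or.inr rfl))
  exact ⟨hW a v hvW ((hv a).2 (Or.inl rfl)), hW b v hvW ((hv b).2 (Or.inr rfl))⟩

theorem maps_restrict (hW : ∀ x y, y ∈ W → E x y → x ∈ W) {f a b : W} :
    Maps (restrict E W) f a b ↔ Maps E (f : M) a b := by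
  constructor
  · rintro ⟨p, hp, hpf⟩
    exact ⟨p, (isPair_restrict hW).1 hp, hpf⟩
  · rintro ⟨p, hp, hpf⟩
    have hpW := hW p f f.2 hpf
    exact ⟨⟨p, hpW⟩, (isPair_restrict hW (p := ⟨p, hpW⟩)).2 hp, hpf⟩

theorem Maps.mem_of_mem (hW : ∀ x y, y ∈ W → E x y → x ∈ W) {f a b : M} (hf : f ∈ W)
    (h : Maps E f a b) : a ∈ W ∧ b ∈ W := by
  obtain ⟨p, hp, hpf⟩ := h
  exact hp.mem_of_mem hW (hW p f hf hpf)

theorem inRange_restrict (hW : ∀ x y, y ∈ W → E x y → x ∈ W) {f j : W} :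
    InRange (restrict E W) f j ↔ InRange E (f : M) j :=
  ⟨fun ⟨n, hn⟩ => ⟨n, (maps_restrict hW).1 hn⟩,
    fun ⟨n, hn⟩ => ⟨⟨n, (hn.mem_of_mem hW f.2).1⟩, (maps_restrict hW).2 hn⟩⟩

variable [hM : Fact (IsModelZF E)] [hN : Fact (IsModelZF (restrict E W))]

theorem zero_restrict (hW : ∀ x y, y ∈ W → E x y → x ∈ W) :
    (zero (restrict E W)).1 = zero E :=
  isEmptySet_iff.1 fun x hx => not_mem_zero (E := restrict E W) ⟨x, hW x _ (Subtype.prop _) hx⟩ hx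

theorem succ_restrict (hW : ∀ x y, y ∈ W → E x y → x ∈ W) (n : W) :
    (succ (restrict E W) n).1 = succ E n.1 := by
  refine isSucc_iff.1 fun x => ⟨fun hx => ?_, fun hx => ?_⟩
  · have := (mem_succ (E := restrict E W) (y := ⟨x, hW x _ (Subtype.prop _) hx⟩)).1 hx
    rwa [Subtype.ext_iff] at this
  · have hxW : x ∈ W := by
      rcases hx with h | rfl
      exacts [hW x n n.2 h, n.2]
    refine (mem_succ (E := restrict E W) (x := n) (y := ⟨x, hxW⟩)).2 ?_
    rwa [Subtype.ext_iff]

/-- The `ω` of `W` is inductive in the ambient model, so it contains every natural number of that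
model. -/
theorem IsNat.restrict (hW : ∀ x y, y ∈ W → E x y → x ∈ W) {n : M} (hn : IsNat E n) :
    ∃ h : n ∈ W, IsNat (SetModel.restrict E W) ⟨n, h⟩ := by
  obtain ⟨w, hw⟩ := exists_omega (E := SetModel.restrict E W)
  have : E n w := by
    refine hn w (isInductive_iff.2 ⟨?_, fun x hx => ?_⟩)
    · rw [← zero_restrict hW]
      exact (hw _).2 isNat_zero
    · have := (hw ⟨x, hW x w w.2 hx⟩).1 hx
      exact succ_restrict hW ⟨x, _⟩ ▸ (hw _).2 this.succ
  exact ⟨hW n w w.2 this, (hw _).1 this⟩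

/-- Although `W` need not be definable, its `ω` is a set of the ambient model. By foundation there,
a failure would give a minimal element of that set which is not a natural number of the ambient
model; it is neither zero nor, by minimality, a successor. -/
theorem isNat_restrict (hW : ∀ x y, y ∈ W → E x y → x ∈ W) {n : W} :
    IsNat (restrict E W) n ↔ IsNat E (n : M) := by
  refine ⟨fun hn => ?_, fun hn => (hn.restrict hW).2⟩
  by_contra hn'
  obtain ⟨w, hw⟩ := exists_omega (E := restrict E W)
  obtain ⟨b, hb⟩ := exists_sep (E := E) (fun x => ¬ IsNat E x) (w : M)
  obtain ⟨y, hy, hy'⟩ := hM.out.foundation b ⟨n, (hb n).2 ⟨(hw n).2 hn, hn'⟩⟩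
  rw [hb] at hy
  have hyW := hW y w w.2 hy.1
  have hcases : ∀ m, IsNat (restrict E W) m →
      m = zero (restrict E W) ∨ ∃ k, IsNat (restrict E W) k ∧ IsSucc (restrict E W) m k :=
    fun m hm => nat_induction (E := restrict E W)
      (fun m => m = zero (restrict E W) ∨
        ∃ k, IsNat (restrict E W) k ∧ IsSucc (restrict E W) m k)
      (Or.inl rfl) (fun k hk _ => Or.inr ⟨k, hk, isSucc_iff.2 rfl⟩) hm
  rcases hcases ⟨y, hyW⟩ ((hw _).1 hy.1) with h | ⟨k, hk, h⟩
  · refine hy.2 ?_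
    rw [show y = zero E from (congrArg Subtype.val h).trans (zero_restrict hW)]
    exact isNat_zero
  · have hyk : y = succ E (k : M) :=
      (congrArg Subtype.val (isSucc_iff.1 h)).trans (succ_restrict hW k)
    refine hy' k (hyk ▸ mem_succ_self (k : M)) ((hb k).2 ⟨(hw k).2 hk, fun hkn => hy.2 ?_⟩)
    exact hyk ▸ hkn.succ

theorem isReal_restrict (hW : ∀ x y, y ∈ W → E x y → x ∈ W) {x : W} :
    IsReal (restrict E W) x ↔ IsReal E (x : M) := by
  -- This eliminates `ω`; what remains concerns members of `x` and natural numbers, on which the two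
  -- models agree.
  rw [isReal_iff, isReal_iff]
  constructor
  · rintro ⟨h1, h2, h3⟩
    refine ⟨fun p hp => ?_, fun n hn => ?_, fun m n a b hmn ha hb => ?_⟩
    · obtain ⟨n, k, hn, hk, h⟩ := h1 ⟨p, hW p x x.2 hp⟩ hp
      exact ⟨n, k, (isNat_restrict hW).1 hn, (isNat_restrict hW).1 hk, (isPair_restrict hW).1 h⟩
    · obtain ⟨hnW, hn⟩ := hn.restrict hW
      obtain ⟨k, hk, hk'⟩ := h2 _ hn
      refine ⟨k, (maps_restrict hW).1 hk, fun l hl => ?_⟩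
      have hlW := (hl.mem_of_mem hW x.2).2
      exact congrArg Subtype.val (hk' ⟨l, hlW⟩ ((maps_restrict hW).2 hl))
    · have hA := ha.mem_of_mem hW x.2
      have hB := hb.mem_of_mem hW x.2
      exact h3 ⟨m, hA.1⟩ ⟨n, hB.1⟩ ⟨a, hA.2⟩ ⟨b, hB.2⟩ hmn ((maps_restrict hW).2 ha)
        ((maps_restrict hW).2 hb)
  · rintro ⟨h1, h2, h3⟩
    refine ⟨fun p hp => ?_, fun n hn => ?_, fun m n a b hmn ha hb => ?_⟩
    · obtain ⟨n, k, hn, hk, h⟩ := h1 p hp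
      obtain ⟨hnW, hn⟩ := hn.restrict hW
      obtain ⟨hkW, hk⟩ := hk.restrict hW
      exact ⟨⟨n, hnW⟩, ⟨k, hkW⟩, hn, hk, (isPair_restrict hW).2 h⟩
    · obtain ⟨k, hk, hk'⟩ := h2 n ((isNat_restrict hW).1 hn)
      refine ⟨⟨k, (hk.mem_of_mem hW x.2).2⟩, (maps_restrict hW).2 hk, fun l hl => ?_⟩
      exact Subtype.ext (hk' l ((maps_restrict hW).1 hl))
    · exact h3 m n a b hmn ((maps_restrict hW).1 ha) ((maps_restrict hW).1 hb)

end Absoluteness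

/-! ### Decoding a real from three interlaced reals -/

section Blocks

variable {N ι : Type*} [LinearOrder N] [LinearOrder ι] {X Y Z B : N → Prop} {A : ι → Prop}
  {β : ι → N} {blk : ι → N → Prop} {m : N}

/-- Within a block `Y` precedes `X`, so an element of `X` coming next after some `i` in `Y` must be
the first one in its block: otherwise `β n ≤ i < j`, and no block can contain `i`. Conversely, an
element of `Y` in block `n` is followed next in `X` by `β n`. Elements of `Y` below `m` belong to no
block and are excluded. -/
theorem starts_iff_of_blocks (hlt : ∀ n n' i j, n < n' → blk n i → blk n' j → i < j)
    (hcover : ∀ j, m ≤ j ↔ ∃ n, blk n j)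
    (hβ : ∀ n, X (β n) ∧ blk n (β n) ∧ ∀ j, X j → blk n j → β n ≤ j)
    (hY : ∀ n, ∃ i, Y i ∧ blk n i)
    (hYX : ∀ n i j, Y i → X j → blk n i → blk n j → i < j) (j : N) :
    (X j ∧ ∃ i, Y i ∧ m ≤ i ∧ i < j ∧ ∀ k, X k → i < k → ¬ k < j) ↔ ∃ n, j = β n := by
  constructor
  · rintro ⟨hXj, i, hYi, hmi, hij, hgap⟩
    obtain ⟨n, hn⟩ := (hcover j).1 (hmi.trans hij.le)
    obtain ⟨h1, h2, h3⟩ := hβ n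
    refine ⟨n, le_antisymm (not_lt.1 fun hlt' => ?_) (h3 j hXj hn)⟩
    have hle : β n ≤ i := not_lt.1 fun h => hgap _ h1 h hlt'
    obtain ⟨n', hn'⟩ := (hcover i).1 hmi
    rcases lt_trichotomy n' n with h | rfl | h
    · exact (hlt _ _ _ _ h hn' h2).not_ge hle
    · exact (hYX _ _ _ hYi h1 hn' h2).not_ge hle
    · exact (hlt _ _ _ _ h hn hn').not_gt hij
  · rintro ⟨n, rfl⟩
    obtain ⟨h1, h2, h3⟩ := hβ n
    obtain ⟨i, hi, hi'⟩ := hY n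
    have hmi := (hcover i).2 ⟨n, hi'⟩
    refine ⟨h1, i, hi, hmi, hYX n i _ hi h1 hi' h2, fun k hk hik hkj => ?_⟩
    obtain ⟨n', hn'⟩ := (hcover k).1 (hmi.trans hik.le)
    rcases lt_trichotomy n' n with h | rfl | h
    · exact (hlt _ _ _ _ h hn' hi').not_gt hik
    · exact (h3 k hk hn').not_gt hkj
    · exact (hlt _ _ _ _ h h2 hn').not_gt hkj

/-- An `l` in `Z` below `β n` and above all earlier starts lies in block `n`: in an earlier block
`i` it would precede `β i`, and in a later block it would exceed `β n`. -/
theorem marked_iff_of_blocks (hlt : ∀ n n' i j, n < n' → blk n i → blk n' j → i < j)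
    (hcover : ∀ j, m ≤ j ↔ ∃ n, blk n j) (hβ : ∀ n, X (β n) ∧ blk n (β n))
    (hZ : ∀ n, (∃ l, Z l ∧ blk n l) ↔ A n)
    (hZX : ∀ n l j, Z l → X j → blk n l → blk n j → l < j)
    (hB : ∀ j, B j ↔ ∃ n, j = β n) (j : N) :
    (B j ∧ ∃ l, Z l ∧ m ≤ l ∧ l < j ∧ ∀ j', B j' → j' < j → j' < l) ↔
      ∃ n, A n ∧ j = β n := by
  constructor
  · rintro ⟨hBj, l, hZl, hml, hlj, hgap⟩
    obtain ⟨n, rfl⟩ := (hB j).1 hBj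
    obtain ⟨i, hi⟩ := (hcover l).1 hml
    rcases lt_trichotomy i n with h | rfl | h
    · exact absurd (hgap (β i) ((hB _).2 ⟨i, rfl⟩) (hlt _ _ _ _ h (hβ i).2 (hβ n).2))
        (hZX i l (β i) hZl (hβ i).1 hi (hβ i).2).not_gt
    · exact ⟨i, (hZ i).1 ⟨l, hZl, hi⟩, rfl⟩
    · exact absurd hlj (hlt _ _ _ _ h (hβ n).2 hi).not_gt
  · rintro ⟨n, hn, rfl⟩
    obtain ⟨l, hl, hl'⟩ := (hZ n).2 hn
    refine ⟨(hB _).2 ⟨n, rfl⟩, l, hl, (hcover l).2 ⟨n, hl'⟩,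
      hZX n l _ hl (hβ n).1 hl' (hβ n).2, fun j' hj' hj'n => ?_⟩
    obtain ⟨i, rfl⟩ := (hB j').1 hj'
    rcases lt_trichotomy i n with h | rfl | h
    · exact hlt _ _ _ _ h (hβ i).2 hl'
    · exact absurd hj'n (lt_irrefl _)
    · exact absurd hj'n (hlt _ _ _ _ h (hβ n).2 (hβ i).2).not_gt

end Blocks

/-! ### Block starts, marked starts and interlaced reals -/

section Decoding

variable {M : Type u} (E : M → M → Prop)

/-- `j` is the first value of `x` after some value of `y` that is at least `m`. -/
def Starts (x y m j : M) : Prop :=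
  InRange E x j ∧ ∃ i, InRange E y i ∧ ¬ E i m ∧ E i j ∧ ∀ k, InRange E x k → E i k → ¬ E k j

/-- `j` starts a block of `x`, and a value of `z` lies between the preceding block and `j`. -/
def Marked (x y z m j : M) : Prop :=
  Starts E x y m j ∧
    ∃ l, InRange E z l ∧ ¬ E l m ∧ E l j ∧ ∀ j', Starts E x y m j' → E j' j → E j' l

/-- `μ(n) ≤ j < μ(n + 1)`. -/
def InBlock (μ n j : M) : Prop :=
  ∃ s a b, IsSucc E s n ∧ Maps E μ n a ∧ Maps E μ s b ∧ ¬ E j a ∧ E j b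

/-- The real `μ` divides `ω` into intervals in which values of `y` and of `z` precede those of
`x`; values of `z` occur precisely in the intervals indexed by values of `r`. -/
structure Interlaced (r x y z μ : M) : Prop where
  real : IsReal E r ∧ IsReal E x ∧ IsReal E y ∧ IsReal E z ∧ IsReal E μ
  exists_x : ∀ n, IsNat E n → ∃ j, InRange E x j ∧ InBlock E μ n j
  exists_y : ∀ n, IsNat E n → ∃ j, InRange E y j ∧ InBlock E μ n j
  exists_z : ∀ n, IsNat E n → ((∃ j, InRange E z j ∧ InBlock E μ n j) ↔ InRange E r n)
  lt_yx : ∀ n i j, InRange E y i → InRange E x j → InBlock E μ n i → InBlock E μ n j → E i j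
  lt_zx : ∀ n i j, InRange E z i → InRange E x j → InBlock E μ n i → InBlock E μ n j → E i j

variable {E}

instance (a b c d : (ℕ → M) → M) [DfnTerm a] [DfnTerm b] [DfnTerm c] [DfnTerm d] :
    Dfn E (fun v => Starts E (a v) (b v) (c v) (d v)) := by unfold Starts; infer_instance

instance (a b c d e : (ℕ → M) → M) [DfnTerm a] [DfnTerm b] [DfnTerm c] [DfnTerm d] [DfnTerm e] :
    Dfn E (fun v => Marked E (a v) (b v) (c v) (d v) (e v)) := by unfold Marked; infer_instance

instance (a b c : (ℕ → M) → M) [DfnTerm a] [DfnTerm b] [DfnTerm c] :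
    Dfn E (fun v => InBlock E (a v) (b v) (c v)) := by unfold InBlock; infer_instance

variable [hM : Fact (IsModelZF E)]

theorem nat_cases {n : M} (hn : IsNat E n) : n = zero E ∨ ∃ k, IsNat E k ∧ n = succ E k := by
  refine nat_induction (E := E) (fun n => n = zero E ∨ ∃ k, IsNat E k ∧ IsSucc E n k)
    (Or.inl rfl) (fun k hk _ => Or.inr ⟨k, hk, isSucc_iff.2 rfl⟩) hn |>.imp_right ?_
  exact fun ⟨k, hk, h⟩ => ⟨k, hk, isSucc_iff.1 h⟩

theorem IsReal.exists_inBlock_iff {μ m j : M} (hμ : IsReal E μ) (hm : Maps E μ (zero E) m)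
    (hj : IsNat E j) : (∃ n, IsNat E n ∧ InBlock E μ n j) ↔ ¬ E j m := by
  constructor
  · rintro ⟨n, hn, s, a, b, hs, ha, hb, hja, hjb⟩ hjm
    have ha' := (hμ.isNat_of_maps ha).2
    rcases mem_trichotomy (isNat_zero (E := E)) hn with h | rfl | h
    · exact hja (mem_trans hjm (hμ.lt h hm ha) ha')
    · exact hja (hμ.functional ha hm ▸ hjm)
    · exact not_mem_zero _ h
  · intro hjm
    obtain ⟨b, hb⟩ := hμ.exists_maps hj.succ
    have hb' := (hμ.isNat_of_maps hb).2
    have hjb : E j b := by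
      rcases hμ.le_value hb with rfl | h
      · exact mem_succ_self j
      · exact mem_trans (mem_succ_self j) h hb'
    -- The least index whose `μ`-value exceeds `j` is not zero, since `j` is not below `μ(0)`; its
    -- predecessor indexes the block of `j`.
    obtain ⟨k, hk, ⟨c, hc, hjc⟩, hmin⟩ :=
      exists_least (E := E) (fun n => ∃ b, Maps E μ n b ∧ E j b) hj.succ ⟨b, hb, hjb⟩
    rcases nat_cases hk with rfl | ⟨n, hn, rfl⟩
    · exact (hjm (hμ.functional hc hm ▸ hjc)).elim
    · obtain ⟨a, ha⟩ := hμ.exists_maps hn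
      refine ⟨n, hn, succ E n, a, c, isSucc_iff.2 rfl, ha, hc, fun hja => ?_, hjc⟩
      rcases hmin n hn ⟨a, ha, hja⟩ with h | h
      · exact mem_irrefl (E := E) n (by simpa only [h] using mem_succ_self (E := E) n)
      · exact mem_irrefl _ (mem_trans h (mem_succ_self n) hn.succ)

theorem InBlock.isNat {μ n j : M} (hμ : IsReal E μ) (h : InBlock E μ n j) :
    IsNat E n ∧ IsNat E j := by
  obtain ⟨s, a, b, -, ha, hb, -, hjb⟩ := h
  exact ⟨(hμ.isNat_of_maps ha).1, (hμ.isNat_of_maps hb).2.mem hjb⟩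

theorem InBlock.lt {μ n n' i j : M} (hμ : IsReal E μ) (hnn : E n n') (hi : InBlock E μ n i)
    (hj : InBlock E μ n' j) : E i j := by
  have hi' := hi.isNat hμ
  have hj' := hj.isNat hμ
  obtain ⟨s, a, b, hs, -, hb, -, hib⟩ := hi
  obtain ⟨-, a', -, -, ha', -, hja', -⟩ := hj
  obtain rfl := isSucc_iff.1 hs
  have hb' := (hμ.isNat_of_maps hb).2
  have ha'' := (hμ.isNat_of_maps ha').2
  have hia : E i a' := by
    rcases succ_le hj'.1 hnn with h | h
    · exact mem_trans hib (hμ.lt h hb ha') ha''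
    · exact hμ.functional (h ▸ hb) ha' ▸ hib
  rcases mem_trichotomy ha'' hj'.2 with h | rfl | h
  · exact mem_trans hia h hj'.2
  · exact hia
  · exact (hja' h).elim

/-- The first values of `x` in the intervals given by `μ` form a real. -/
theorem Interlaced.exists_first {r x y z μ : M} (h : Interlaced E r x y z μ) :
    ∃ β, IsReal E β ∧ ∀ n j, Maps E β n j ↔ IsNat E n ∧
      InRange E x j ∧ InBlock E μ n j ∧ ∀ k, InRange E x k → InBlock E μ n k → ¬ E k j := by
  have hμ := h.real.2.2.2.2
  refine exists_isReal_of_step (E := E) (fun n j => InRange E x j ∧ InBlock E μ n j ∧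
    ∀ k, InRange E x k → InBlock E μ n k → ¬ E k j) (fun n hn => ?_) ?_ ?_
  · obtain ⟨j, hj⟩ := h.exists_x n hn
    obtain ⟨b, hb, ⟨hb1, hb2⟩, hmin⟩ := exists_least (E := E)
      (fun j => InRange E x j ∧ InBlock E μ n j) (hj.2.isNat hμ).2 hj
    refine ⟨b, ⟨hb1, hb2, fun k hk hk' hkb => ?_⟩, ?_⟩
    · rcases hmin k (hk'.isNat hμ).2 ⟨hk, hk'⟩ with rfl | h
      · exact mem_irrefl _ hkb
      · exact mem_irrefl _ (mem_trans h hkb hb)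
    · rintro c ⟨hc1, hc2, hc3⟩
      rcases hmin c (hc2.isNat hμ).2 ⟨hc1, hc2⟩ with h | h
      · exact h.symm
      · exact (hc3 b hb1 hb2 h).elim
  · exact fun n k _ hk => (hk.2.1.isNat hμ).2
  · exact fun n a b hn ha hb => ha.2.1.lt hμ (mem_succ_self n) hb.2.1

/-- The two block lemmas, applied to the order of the model's natural numbers. The right-hand sides
are the ranges of `β` and of `β ∘ r`, while the left-hand sides mention neither `r` nor `μ`. -/
theorem Interlaced.starts_and_marked {r x y z μ m β : M} (h : Interlaced E r x y z μ)
    (hm : Maps E μ (zero E) m) (hβ : IsReal E β)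
    (hβ' : ∀ n j, Maps E β n j ↔ IsNat E n ∧ InRange E x j ∧ InBlock E μ n j ∧
      ∀ k, InRange E x k → InBlock E μ n k → ¬ E k j) (j : M) :
    (Starts E x y m j ↔ InRange E β j) ∧
      (Marked E x y z m j ↔ ∃ n, InRange E r n ∧ Maps E β n j) := by
  obtain ⟨hr, hx, hy, hz, hμ⟩ := h.real
  have hm' := (hμ.isNat_of_maps hm).2
  choose b hb using fun n : Nt E => hβ.exists_maps n.2
  let β' : Nt E → Nt E := fun n => ⟨b n, (hβ.isNat_of_maps (hb n)).2⟩
  let m' : Nt E := ⟨m, hm'⟩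
  have hlt : ∀ n n' i j : Nt E, n < n' → InBlock E μ n.1 i.1 → InBlock E μ n'.1 j.1 → i < j :=
    fun n n' i j hn hi hj => InBlock.lt (E := E) hμ hn hi hj
  have hcover : ∀ j : Nt E, m' ≤ j ↔ ∃ n : Nt E, InBlock E μ n.1 j.1 := by
    intro j
    rw [← not_lt]
    refine (hμ.exists_inBlock_iff hm j.2).symm.trans ?_
    exact ⟨fun ⟨n, hn, h⟩ => ⟨⟨n, hn⟩, h⟩, fun ⟨n, h⟩ => ⟨n.1, n.2, h⟩⟩
  have hfirst : ∀ n : Nt E, InRange E x (β' n).1 ∧ InBlock E μ n.1 (β' n).1 ∧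
      ∀ j : Nt E, InRange E x j.1 → InBlock E μ n.1 j.1 → β' n ≤ j := by
    intro n
    have := ((hβ' _ _).1 (hb n)).2
    exact ⟨this.1, this.2.1, fun j hj hj' => not_lt.1 (this.2.2 j.1 hj hj')⟩
  have hstarts : ∀ j, Starts E x y m j ↔ ∃ n : Nt E, j = b n := by
    intro j
    have key := starts_iff_of_blocks hlt hcover hfirst (Y := fun i => InRange E y i.1)
      (fun n => by
        obtain ⟨i, hi, hi'⟩ := h.exists_y n.1 n.2
        exact ⟨⟨i, hy.isNat_of_inRange hi⟩, hi, hi'⟩)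
      (fun n i j hi hj hi' hj' => h.lt_yx n.1 i.1 j.1 hi hj hi' hj')
    constructor
    · rintro ⟨hxj, i, hyi, him, hij, hgap⟩
      obtain ⟨n, hn⟩ := (key ⟨j, hx.isNat_of_inRange hxj⟩).1
        ⟨hxj, ⟨i, hy.isNat_of_inRange hyi⟩, hyi, not_lt.1 him, hij, fun k => hgap k.1⟩
      exact ⟨n, congrArg Subtype.val hn⟩
    · rintro ⟨n, rfl⟩
      obtain ⟨hxj, i, hyi, him, hij, hgap⟩ := (key (β' n)).2 ⟨n, rfl⟩
      exact ⟨hxj, i.1, hyi, not_lt.2 him, hij,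
        fun k hk => hgap ⟨k, hx.isNat_of_inRange hk⟩ hk⟩
  have hmarked : Marked E x y z m j ↔ ∃ n : Nt E, InRange E r n.1 ∧ j = b n := by
    have key := marked_iff_of_blocks (B := fun j => Starts E x y m j.1)
      (Z := fun i => InRange E z i.1) (A := fun n => InRange E r n.1) hlt hcover
      (fun n => ⟨(hfirst n).1, (hfirst n).2.1⟩)
      (fun n => by
        rw [← h.exists_z n.1 n.2]
        exact ⟨fun ⟨l, hl⟩ => ⟨l.1, hl⟩, fun ⟨l, hl⟩ => ⟨⟨l, hz.isNat_of_inRange hl.1⟩, hl⟩⟩)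
      (fun n i j hi hj hi' hj' => h.lt_zx n.1 i.1 j.1 hi hj hi' hj')
      (fun j => (hstarts j.1).trans (exists_congr fun n =>
        ⟨fun h => Subtype.ext h, fun h => congrArg Subtype.val h⟩))
    constructor
    · rintro ⟨hs, l, hl, hlm, hlj, hgap⟩
      obtain ⟨n, hn, hn'⟩ := (key ⟨j, hx.isNat_of_inRange hs.1⟩).1
        ⟨hs, ⟨l, hz.isNat_of_inRange hl⟩, hl, not_lt.1 hlm, hlj, fun k => hgap k.1⟩
      exact ⟨n, hn, congrArg Subtype.val hn'⟩
    · rintro ⟨n, hn, rfl⟩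
      obtain ⟨hs, l, hl, hlm, hlj, hgap⟩ := (key (β' n)).2 ⟨n, hn, rfl⟩
      exact ⟨hs, l.1, hl, not_lt.2 hlm, hlj,
        fun k hk => hgap ⟨k, hx.isNat_of_inRange hk.1⟩ hk⟩
  refine ⟨(hstarts j).trans ⟨?_, ?_⟩, hmarked.trans ⟨?_, ?_⟩⟩
  · rintro ⟨n, rfl⟩
    exact ⟨n.1, hb n⟩
  · rintro ⟨n, hn⟩
    have hn' := (hβ.isNat_of_maps hn).1
    exact ⟨⟨n, hn'⟩, hβ.functional hn (hb ⟨n, hn'⟩)⟩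
  · rintro ⟨n, hn, rfl⟩
    exact ⟨n.1, hn, hb n⟩
  · rintro ⟨n, hn, hn'⟩
    exact ⟨⟨n, hr.isNat_of_inRange hn⟩, hn, hβ.functional hn' (hb ⟨n, _⟩)⟩

theorem IsReal.exists_maps_gt {x m : M} (hx : IsReal E x) (hm : IsNat E m) :
    ∃ n k, IsNat E n ∧ E m n ∧ Maps E x n k ∧ E m k := by
  obtain ⟨k, hk⟩ := hx.exists_maps hm.succ
  refine ⟨succ E m, k, hm.succ, mem_succ_self m, hk, ?_⟩
  rcases hx.le_value hk with rfl | h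
  · exact mem_succ_self m
  · exact mem_trans (mem_succ_self m) h (hx.isNat_of_maps hk).2

/-- The composition of two reals. -/
theorem IsReal.exists_comp {r β : M} (hr : IsReal E r) (hβ : IsReal E β) :
    ∃ c, IsReal E c ∧ ∀ n j, Maps E c n j ↔ ∃ k, Maps E r n k ∧ Maps E β k j := by
  obtain ⟨c, hc, hc'⟩ : ∃ c, IsReal E c ∧ ∀ n j, Maps E c n j ↔
      IsNat E n ∧ ∃ k, Maps E r n k ∧ Maps E β k j := by
    refine exists_isReal_of_step (E := E)
      (fun n j => ∃ k, Maps E r n k ∧ Maps E β k j) (fun n hn => ?_) ?_ ?_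
    · obtain ⟨k, hk⟩ := hr.exists_maps hn
      obtain ⟨j, hj⟩ := hβ.exists_maps (hr.isNat_of_maps hk).2
      refine ⟨j, ⟨k, hk, hj⟩, ?_⟩
      rintro j' ⟨k', hk', hj'⟩
      obtain rfl := hr.functional hk hk'
      exact hβ.functional hj' hj
    · exact fun n j _ ⟨k, _, hj⟩ => (hβ.isNat_of_maps hj).2
    · rintro n a b hn ⟨k, hk, ha⟩ ⟨l, hl, hb⟩
      exact hβ.lt (hr.lt (mem_succ_self n) hk hl) ha hb
  refine ⟨c, hc, fun n j => (hc' n j).trans (and_iff_right_of_imp ?_)⟩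
  exact fun ⟨k, hk, _⟩ => (hr.isNat_of_maps hk).1

end Decoding

/-! ### Decoding inside a subuniverse -/

section Decoding

variable {M : Type u} {E : M → M → Prop} {W : Set M}

theorem InRange.mem_of_mem (hW : ∀ x y, y ∈ W → E x y → x ∈ W) {x j : M} (hx : x ∈ W)
    (h : InRange E x j) : j ∈ W := (h.choose_spec.mem_of_mem hW hx).2

theorem starts_restrict (hW : ∀ x y, y ∈ W → E x y → x ∈ W) {x y m j : W} :
    Starts (restrict E W) x y m j ↔ Starts E (x : M) y m j := by
  simp only [Starts, inRange_restrict hW]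
  refine and_congr_right fun _ => ⟨?_, ?_⟩
  · rintro ⟨i, hi, h1, h2, h3⟩
    exact ⟨i, hi, h1, h2, fun k hk => h3 ⟨k, InRange.mem_of_mem hW x.2 hk⟩ hk⟩
  · rintro ⟨i, hi, h1, h2, h3⟩
    exact ⟨⟨i, InRange.mem_of_mem hW y.2 hi⟩, hi, h1, h2, fun k hk => h3 k hk⟩

theorem marked_restrict (hW : ∀ x y, y ∈ W → E x y → x ∈ W) {x y z m j : W} :
    Marked (restrict E W) x y z m j ↔ Marked E (x : M) y z m j := by
  simp only [Marked, starts_restrict hW, inRange_restrict hW]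
  refine and_congr_right fun _ => ⟨?_, ?_⟩
  · rintro ⟨i, hi, h1, h2, h3⟩
    exact ⟨i, hi, h1, h2, fun k hk => h3 ⟨k, InRange.mem_of_mem hW x.2 hk.1⟩ hk⟩
  · rintro ⟨i, hi, h1, h2, h3⟩
    exact ⟨⟨i, InRange.mem_of_mem hW z.2 hi⟩, hi, h1, h2, fun k hk => h3 k hk⟩

variable [hM : Fact (IsModelZF E)] [hN : Fact (IsModelZF (restrict E W))]

/-- If a definable class of `(W, E)` is the range of a real of `(M, E)`, then that real is
in `W`. -/
theorem IsReal.mem_of_range_definable (hW : ∀ x y, y ∈ W → E x y → x ∈ W) {c : M}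
    (hc : IsReal E c) (P : W → Prop) [Dfn (restrict E W) fun v => P (v 0)]
    (h : ∀ j : W, P j ↔ InRange E c j) : c ∈ W := by
  -- The enumeration is carried out in `W`, where `P` is unbounded because `c` is; the resulting
  -- real has the same range as `c` and therefore equals it.
  obtain ⟨e, he, he'⟩ := exists_enumeration (E := restrict E W) P
    (fun n hn => (isNat_restrict hW).2 (hc.isNat_of_inRange ((h n).1 hn))) fun m hm => by
      obtain ⟨n, k, -, -, hk, hmk⟩ := hc.exists_maps_gt ((isNat_restrict hW).1 hm)
      have hkW := ((hc.isNat_of_maps hk).2.restrict hW).1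
      exact ⟨⟨k, hkW⟩, (h _).2 ⟨n, hk⟩, hmk⟩
  suffices c = e from this ▸ e.2
  refine hc.eq_of_range_eq ((isReal_restrict hW).1 he) fun j => ⟨fun hj => ?_, fun hj => ?_⟩
  · have hjW := ((hc.isNat_of_inRange hj).restrict hW).1
    exact (inRange_restrict hW (j := ⟨j, hjW⟩)).1 ((he' _).2 ((h _).2 hj))
  · have hjW := InRange.mem_of_mem hW e.2 hj
    exact (h ⟨j, hjW⟩).1 ((he' _).1 ((inRange_restrict hW).2 hj))

/-- `W` obtains `β` from the starts and `c = β ∘ r` from the marked starts, and then recovers the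
range of `r` as the `β`-preimage of the range of `c`. From `μ` only the number `m = μ(0)` enters,
and numbers are always in `W`. -/
theorem Interlaced.mem (hW : ∀ x y, y ∈ W → E x y → x ∈ W) {r x y z μ : M}
    (h : Interlaced E r x y z μ) (hx : x ∈ W) (hy : y ∈ W) (hz : z ∈ W) : r ∈ W := by
  have hr := h.real.1
  obtain ⟨m, hm⟩ := h.real.2.2.2.2.exists_maps isNat_zero
  have hmW := ((h.real.2.2.2.2.isNat_of_maps hm).2.restrict hW).1
  obtain ⟨β, hβ, hβ'⟩ := h.exists_first
  have key := h.starts_and_marked hm hβ hβ'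
  obtain ⟨c, hc, hc'⟩ := hr.exists_comp hβ
  lift x to W using hx
  lift y to W using hy
  lift z to W using hz
  lift m to W using hmW
  have hβW : β ∈ W := hβ.mem_of_range_definable hW (fun j => Starts (restrict E W) x y m j)
    fun j => (starts_restrict hW).trans (key j).1
  have hcW : c ∈ W := hc.mem_of_range_definable hW (fun j => Marked (restrict E W) x y z m j)
    fun j => (marked_restrict hW).trans <| (key j).2.trans <| by
      simp only [InRange, hc']
      exact ⟨fun ⟨n, ⟨i, hi⟩, hn⟩ => ⟨i, n, hi, hn⟩, fun ⟨i, n, hi, hn⟩ => ⟨n, ⟨i, hi⟩, hn⟩⟩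
  lift β to W using hβW
  lift c to W using hcW
  have hR : ∀ k, InRange E r k ↔ ∃ n j, Maps E c.1 n j ∧ Maps E β.1 k j := by
    intro k
    simp only [hc']
    constructor
    · rintro ⟨n, hn⟩
      obtain ⟨j, hj⟩ := hβ.exists_maps (hr.isNat_of_maps hn).2
      exact ⟨n, j, ⟨k, hn, hj⟩, hj⟩
    · rintro ⟨n, j, ⟨k', hn, hj⟩, hj'⟩
      exact ⟨n, hβ.injective hj hj' ▸ hn⟩
  refine hr.mem_of_range_definable hW
    (fun k => ∃ n j, Maps (restrict E W) c n j ∧ Maps (restrict E W) β k j) fun k => ?_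
  rw [hR]
  simp only [maps_restrict hW]
  constructor
  · exact fun ⟨n, j, h⟩ => ⟨n, j, h⟩
  · exact fun ⟨n, j, h⟩ => ⟨⟨n, (h.1.mem_of_mem hW c.2).1⟩, ⟨j, (h.1.mem_of_mem hW c.2).2⟩, h⟩

end Decoding

/-! ### Canonical extensions of nodes of a superperfect tree -/

section Trees

variable {M : Type u} (E : M → M → Prop)

/-- The order on finite sequences by the greatest element of the symmetric difference of the
ranges. -/
def RangeLt (a b : M) : Prop :=
  ∃ k, IsNat E k ∧ InRange E b k ∧ ¬ InRange E a k ∧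
    ∀ j, IsNat E j → E k j → (InRange E a j ↔ InRange E b j)

/-- `t` is an `ω`-splitting node of `T` that extends `s`; its values beyond those of `s` are at
least `m` and exist, and `m'` bounds all its values. -/
def Extends (T s m t m' : M) : Prop :=
  IsNat E m' ∧ E t T ∧ IsOmegaSplitting E T t ∧ IsSubset E s t ∧
    (∀ j, InRange E t j → InRange E s j ∨ ¬ E j m) ∧ (∃ j, InRange E t j ∧ ¬ E j m) ∧
    ∀ j, InRange E t j → E j m'

/-- `(m', t)` is the least pair that extends `s` beyond `m`. -/
def LeastExtends (T s m t m' : M) : Prop :=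
  Extends E T s m t m' ∧ (∀ t' l, Extends E T s m t' l → ¬ E l m') ∧
    ∀ t', Extends E T s m t' m' → t' = t ∨ RangeLt E t t'

variable {E}

instance (s t : (ℕ → M) → M) [DfnTerm s] [DfnTerm t] :
    Dfn E (fun v => RangeLt E (s v) (t v)) := by unfold RangeLt; infer_instance

instance (a b c d e : (ℕ → M) → M) [DfnTerm a] [DfnTerm b] [DfnTerm c] [DfnTerm d] [DfnTerm e] :
    Dfn E (fun v => Extends E (a v) (b v) (c v) (d v) (e v)) := by unfold Extends; infer_instance

instance (a b c d e : (ℕ → M) → M) [DfnTerm a] [DfnTerm b] [DfnTerm c] [DfnTerm d] [DfnTerm e] :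
    Dfn E (fun v => LeastExtends E (a v) (b v) (c v) (d v) (e v)) := by
  unfold LeastExtends; infer_instance

theorem IsFinSeq.isNat_of_inRange {s j : M} (hs : IsFinSeq E s) (h : InRange E s j) :
    IsNat E j := by
  obtain ⟨d, _, hs⟩ := hs
  exact hs.isNat_of_inRange h

theorem IsSubset.maps {f g n k : M} (h : IsSubset E f g) (hf : Maps E f n k) : Maps E g n k := by
  obtain ⟨p, hp, hpf⟩ := hf
  exact ⟨p, hp, h p hpf⟩

variable [hM : Fact (IsModelZF E)]

theorem IsFinSeq.eq_of_range_eq {s t : M} (hs : IsFinSeq E s) (ht : IsFinSeq E t)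
    (h : ∀ j, IsNat E j → (InRange E s j ↔ InRange E t j)) : s = t := by
  have h' : ∀ j, InRange E s j ↔ InRange E t j := fun j =>
    ⟨fun hj => (h j (hs.isNat_of_inRange hj)).1 hj, fun hj => (h j (ht.isNat_of_inRange hj)).2 hj⟩
  obtain ⟨d, hd, hs⟩ := hs
  obtain ⟨d', hd', ht⟩ := ht
  exact hs.eq_of_range_eq (isNatInitial_of_isNat hd) ht (isNatInitial_of_isNat hd') h'

theorem IsFinSeq.exists_bound {s : M} (hs : IsFinSeq E s) :
    ∃ m, IsNat E m ∧ ∀ j, InRange E s j → E j m := by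
  obtain ⟨d, hd, hs⟩ := hs
  rcases nat_cases hd with rfl | ⟨e, he, rfl⟩
  · exact ⟨zero E, isNat_zero, fun j ⟨n, hn⟩ => (not_mem_zero n (hs.of_maps hn).1).elim⟩
  · obtain ⟨a, ha, -⟩ := hs.2.1 e (mem_succ_self e)
    have ha' := (hs.of_maps ha).2
    refine ⟨succ E a, ha'.succ, fun j ⟨n, hn⟩ => ?_⟩
    rcases mem_succ.1 (hs.of_maps hn).1 with h | rfl
    · exact mem_succ.2 (Or.inl (hs.2.2 n e j a h hn ha))
    · rw [hs.functional hn ha]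
      exact mem_succ_self a

theorem RangeLt.asymm {a b : M} (h : RangeLt E a b) (h' : RangeLt E b a) : False := by
  obtain ⟨k, hk, hkb, hka, hab⟩ := h
  obtain ⟨l, hl, hla, hlb, hba⟩ := h'
  rcases mem_trichotomy hk hl with h | rfl | h
  · exact hlb ((hab l hl h).1 hla)
  · exact hka hla
  · exact hka ((hba k hk h).1 hkb)

/-- Decide membership in the range from the top down: if some sequence omits the largest undecided
number, discard those that contain it, as they are greater. -/
theorem exists_rangeLt_least {S s : M} (hs : E s S) (hS : ∀ s, E s S → IsFinSeq E s) {m : M}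
    (hm : IsNat E m) (hbd : ∀ s, E s S → ∀ j, InRange E s j → E j m) :
    ∃ a, E a S ∧ ∀ t, E t S → t = a ∨ RangeLt E a t := by
  -- The induction needs a weaker hypothesis than boundedness: the ranges merely agree from `m` on.
  have key := nat_induction (E := E) (fun m => ∀ S, (∃ s, E s S) → (∀ s, E s S → IsFinSeq E s) →
    (∀ s t, E s S → E t S → ∀ j, IsNat E j → ¬ E j m → (InRange E s j ↔ InRange E t j)) →
    ∃ a, E a S ∧ ∀ t, E t S → t = a ∨ RangeLt E a t) ?_ ?_ hm
  · refine key S ⟨s, hs⟩ hS fun s t hs ht j _ hj => iff_of_false ?_ ?_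
    exacts [fun h => hj (hbd s hs j h), fun h => hj (hbd t ht j h)]
  · rintro S ⟨s, hs⟩ hS h
    exact ⟨s, hs, fun t ht => Or.inl ((hS t ht).eq_of_range_eq (hS s hs) fun j hj =>
      h t s ht hs j hj (not_mem_zero j))⟩
  · rintro k hk ih S ⟨s, hs⟩ hS h
    by_cases hall : ∀ s, E s S → InRange E s k
    · refine ih S ⟨s, hs⟩ hS fun s t hs ht j hj hjk => ?_
      by_cases hj' : j = k
      · subst hj'
        exact iff_of_true (hall s hs) (hall t ht)
      · exact h s t hs ht j hj fun h => (mem_succ.1 h).elim hjk hj'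
    · push Not at hall
      obtain ⟨s₀, hs₀, hks₀⟩ := hall
      obtain ⟨S₀, hS₀⟩ := exists_sep (E := E) (fun s => ¬ InRange E s k) S
      obtain ⟨a, ha, hmin⟩ := ih S₀ ⟨s₀, (hS₀ s₀).2 ⟨hs₀, hks₀⟩⟩
        (fun s hs => hS s ((hS₀ s).1 hs).1) fun s t hs ht j hj hjk => by
          rw [hS₀] at hs ht
          by_cases hj' : j = k
          · subst hj'
            exact iff_of_false hs.2 ht.2
          · exact h s t hs.1 ht.1 j hj fun h => (mem_succ.1 h).elim hjk hj'
      rw [hS₀] at ha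
      refine ⟨a, ha.1, fun t ht => ?_⟩
      by_cases hkt : InRange E t k
      · refine Or.inr ⟨k, hk, hkt, ha.2, fun j hj hkj => h a t ha.1 ht j hj fun hjk => ?_⟩
        rcases mem_succ.1 hjk with h | rfl
        · exact mem_irrefl _ (mem_trans hkj h hk)
        · exact mem_irrefl _ hkj
      · exact hmin t ((hS₀ t).2 ⟨ht, hkt⟩)

theorem Extends.lt {T s m t m' : M} (hm : IsNat E m) (h : Extends E T s m t m') : E m m' := by
  obtain ⟨hm', -, -, -, -, ⟨j, hj, hjm⟩, hb⟩ := h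
  have hjm' := hb j hj
  rcases mem_trichotomy hm (hm'.mem hjm') with h | rfl | h
  · exact mem_trans h hjm' hm'
  · exact hjm'
  · exact (hjm h).elim

/-- Splitting gives a successor `s ⌢ k` in `T` with `k > m`, and superperfectness extends it to a
splitting node. All values after `s` are at least `k`, since sequences increase. -/
theorem exists_extends {T s m : M} (hT : IsSuperperfectTree E T)
    (hs : IsOmegaSplitting E T s) (hm : IsNat E m) : ∃ t m', Extends E T s m t m' := by
  obtain ⟨k, hk, hmk, u, ⟨d, ⟨hd, hsd⟩, hu⟩, huT⟩ := hs m hm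
  obtain ⟨t, htT, hut, htsplit⟩ := hT.2 u huT
  have ht := hT.1.2.1 t htT
  obtain ⟨m', hm', hbd⟩ := ht.exists_bound
  have hst : IsSubset E s t := fun p hp => hut p ((hu p).2 (Or.inl hp))
  have hdk : Maps E t d k := hut.maps ((maps_of_adjoin hu d k).2 (Or.inr ⟨rfl, rfl⟩))
  have hkm : ¬ E k m := fun h => mem_irrefl _ (mem_trans h hmk hk)
  refine ⟨t, m', hm', htT, htsplit, hst, ?_, ⟨k, ⟨d, hdk⟩, hkm⟩, hbd⟩
  rintro j ⟨n, hn⟩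
  obtain ⟨D, hD, htD⟩ := ht
  rcases mem_trichotomy (hD.mem (htD.of_maps hn).1) hd with h | rfl | h
  · obtain ⟨i, hi, -⟩ := hsd.2.1 n h
    obtain rfl := htD.functional (hst.maps hi) hn
    exact Or.inl ⟨n, hi⟩
  · obtain rfl := htD.functional hdk hn
    exact Or.inr hkm
  · have hkj := htD.2.2 d n k j h hdk hn
    exact Or.inr fun hjm => hkm (mem_trans hkj hjm hm)

/-- Minimizing the bound first leaves sequences with uniformly bounded values, among which `RangeLt`
has a least element. This canonical selection takes the place of choice. -/
theorem exists_leastExtends {T s m : M} (hT : IsSuperperfectTree E T)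
    (hs : IsOmegaSplitting E T s) (hm : IsNat E m) : ∃ t m', LeastExtends E T s m t m' := by
  obtain ⟨t₀, l₀, h₀⟩ := exists_extends hT hs hm
  obtain ⟨m', hm', ⟨t₁, h₁⟩, hmin⟩ :=
    exists_least (E := E) (fun l => ∃ t, Extends E T s m t l) h₀.1 ⟨t₀, h₀⟩
  obtain ⟨S, hS⟩ := exists_sep (E := E) (fun t => Extends E T s m t m') T
  obtain ⟨t, ht, ht'⟩ := exists_rangeLt_least ((hS t₁).2 ⟨h₁.2.1, h₁⟩)
    (fun t ht => hT.1.2.1 t ((hS t).1 ht).1) hm'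
    fun t ht => ((hS t).1 ht).2.2.2.2.2.2.2
  refine ⟨t, m', ((hS t).1 ht).2, fun t' l h hl => ?_, fun t' h => ht' t' ((hS t').2 ⟨h.2.1, h⟩)⟩
  rcases hmin l h.1 ⟨t', h⟩ with rfl | h'
  · exact mem_irrefl _ hl
  · exact mem_irrefl _ (mem_trans hl h' h.1)

theorem LeastExtends.unique {T s m t m' t' l : M} (h : LeastExtends E T s m t m')
    (h' : LeastExtends E T s m t' l) : t = t' ∧ m' = l := by
  obtain rfl : m' = l := by
    rcases mem_trichotomy h.1.1 h'.1.1 with hl | hl | hl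
    exacts [(h'.2.1 t m' h.1 hl).elim, hl, (h.2.1 t' l h'.1 hl).elim]
  refine ⟨?_, rfl⟩
  rcases h.2.2 t' h'.1 with h1 | h1
  · exact h1.symm
  · rcases h'.2.2 t h.1 with h2 | h2
    · exact h2
    · exact (h1.asymm h2).elim

/-! ### Branches as limits of nodes -/

/-- The branch is the union of the chain of nodes. Values added after stage `n` are at least `μ(n)`,
so below `μ(n)` the branch agrees with the node at stage `n`. Growth is required only at arbitrarily
late stages, since the nodes for `z` stay fixed at stages outside the range of `r`. -/
theorem exists_branch_of_nodes {T μ : M} (hT : IsTree E T) (hμ : IsReal E μ) (Q : M → M → Prop)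
    [hQ : Dfn E fun v => Q (v 0) (v 1)] (hex : ∀ n, IsNat E n → ∃ s, Q n s)
    (huniq : ∀ n s t, IsNat E n → Q n s → Q n t → s = t)
    (hQT : ∀ n s, IsNat E n → Q n s → E s T)
    (hbd : ∀ n s m, Q n s → Maps E μ n m → ∀ j, InRange E s j → E j m)
    (hstep : ∀ n s t m, Q n s → Q (succ E n) t → Maps E μ n m →
      IsSubset E s t ∧ ∀ j, InRange E t j → InRange E s j ∨ ¬ E j m)
    (hgrow : ∀ n m, IsNat E n → Maps E μ n m →
      ∃ n' s j, IsNat E n' ∧ E n n' ∧ Q n' s ∧ InRange E s j ∧ ¬ E j m) :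
    ∃ x, IsBranch E T x ∧ ∀ n s m, Q n s → Maps E μ n m → ∀ j, E j m →
      (InRange E x j ↔ InRange E s j) := by
  have := fun s t [DfnTerm s] [DfnTerm t] => hQ.subst₂ s t
  have hmono : ∀ n' n s s', IsNat E n' → E n n' → Q n s → Q n' s' → IsSubset E s s' ∧
      ∀ m, Maps E μ n m → ∀ j, InRange E s' j → E j m → InRange E s j := by
    intro n' n s s' hn' hnn hs hs'
    refine nat_induction (E := E) (fun n' => ∀ n, E n n' → ∀ s s', Q n s → Q n' s' →
      IsSubset E s s' ∧ ∀ m, Maps E μ n m → ∀ j, InRange E s' j → E j m → InRange E s j)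
      ?_ ?_ hn' n hnn s s' hs hs'
    · exact fun n hn => (not_mem_zero n hn).elim
    · intro n' hn' ih n hn s s' hs hs'
      obtain ⟨t, ht⟩ := hex n' hn'
      obtain ⟨l, hl⟩ := hμ.exists_maps hn'
      obtain ⟨h1, h2⟩ := hstep n' t s' l ht hs' hl
      rcases mem_succ.1 hn with hnn | rfl
      · obtain ⟨h3, h4⟩ := ih n hnn s t hs ht
        refine ⟨fun p hp => h1 p (h3 p hp), fun m hm j hj hjm => h4 m hm j ?_ hjm⟩
        refine (h2 j hj).resolve_right fun h => h ?_
        exact mem_trans hjm (hμ.lt hnn hm hl) (hμ.isNat_of_maps hl).2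
      · obtain rfl := huniq n s t hn' hs ht
        refine ⟨h1, fun m hm j hj hjm => (h2 j hj).resolve_right fun h => h ?_⟩
        exact hμ.functional hm hl ▸ hjm
  have hdir : ∀ n n' s s', IsNat E n → IsNat E n' → Q n s → Q n' s' →
      ∃ N S, IsNat E N ∧ Q N S ∧ IsSubset E s S ∧ IsSubset E s' S := by
    intro n n' s s' hn hn' hs hs'
    rcases mem_trichotomy hn hn' with h | rfl | h
    · exact ⟨n', s', hn', hs', (hmono n' n s s' hn' h hs hs').1, fun _ h => h⟩
    · obtain rfl := huniq n s s' hn hs hs'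
      exact ⟨n, s, hn, hs, fun _ h => h, fun _ h => h⟩
    · exact ⟨n, s, hn, hs, fun _ h => h, (hmono n n' s' s hn h hs' hs).1⟩
  have hseq : ∀ n s, IsNat E n → Q n s → IsFinSeq E s := fun n s hn hs => hT.2.1 s (hQT n s hn hs)
  have hlow : ∀ {s i l a}, IsFinSeq E s → Maps E s l a → (E i l ∨ i = l) → ∃ k, Maps E s i k := by
    rintro s i l a ⟨d, hd, hs⟩ hl hi
    have hid : E i d := by
      rcases hi with hi | rfl
      exacts [mem_trans hi (hs.of_maps hl).1 hd, (hs.of_maps hl).1]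
    exact (hs.2.1 i hid).exists
  obtain ⟨U, hU⟩ := hM.out.union T
  -- The set `⋃ T` serves only as a bound for separation.
  obtain ⟨x, hx⟩ := exists_sep (E := E) (fun p => ∃ n s, IsNat E n ∧ Q n s ∧ E p s) U
  replace hx : ∀ p, E p x ↔ ∃ n s, IsNat E n ∧ Q n s ∧ E p s := fun p => by
    rw [hx, hU]
    exact and_iff_right_of_imp fun ⟨n, s, hn, hs, hp⟩ => ⟨s, hQT n s hn hs, hp⟩
  have hxm : ∀ i k, Maps E x i k ↔ ∃ n s, IsNat E n ∧ Q n s ∧ Maps E s i k := by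
    intro i k
    obtain ⟨p, hp⟩ := exists_pair (E := E) i k
    simp only [maps_iff hp, hx]
  have hxfun : ∀ i k l, Maps E x i k → Maps E x i l → k = l := by
    intro i k l hk hl
    obtain ⟨n, s, hn, hs, hk⟩ := (hxm i k).1 hk
    obtain ⟨n', s', hn', hs', hl⟩ := (hxm i l).1 hl
    obtain ⟨N, S, hN, hS, h1, h2⟩ := hdir n n' s s' hn hn' hs hs'
    obtain ⟨d, -, hd⟩ := hseq N S hN hS
    exact hd.functional (h1.maps hk) (h2.maps hl)
  have hxex : ∀ i, IsNat E i → ∃ n s k, IsNat E n ∧ Q n s ∧ Maps E s i k := by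
    intro i hi
    refine nat_induction (E := E) (fun i => ∃ n s k, IsNat E n ∧ Q n s ∧ Maps E s i k) ?_ ?_ hi
    · obtain ⟨m, hm⟩ := hμ.exists_maps isNat_zero
      obtain ⟨n, s, j, hn, -, hs, ⟨l, hl⟩, -⟩ := hgrow _ m isNat_zero hm
      have hlnat : IsNat E l := by
        obtain ⟨d, hd, hs⟩ := hseq n s hn hs
        exact hd.mem (hs.of_maps hl).1
      obtain ⟨k, hk⟩ := hlow (i := zero E) (hseq n s hn hs) hl (by
        rcases mem_trichotomy (isNat_zero (E := E)) hlnat with h | h | h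
        exacts [Or.inl h, Or.inr h, (not_mem_zero _ h).elim])
      exact ⟨n, s, k, hn, hs, hk⟩
    · rintro i hi ⟨n, s, k, hn, hs, hk⟩
      obtain ⟨m, hm⟩ := hμ.exists_maps hn
      -- The later node has a value `j ≥ μ(n) > k`, so its position is past `i`, and position `i +
      -- 1` is also in the domain.
      obtain ⟨n', s', j, hn', hnn, hs', ⟨l, hl⟩, hjm⟩ := hgrow n m hn hm
      have hk' := (hmono n' n s s' hn' hnn hs hs').1.maps hk
      have hkm := hbd n s m hs hm k ⟨i, hk⟩
      obtain ⟨d, hd, hs'd⟩ := id (hseq n' s' hn' hs')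
      have hjn := (hs'd.of_maps hl).2
      have hkj : E k j := by
        rcases mem_trichotomy (hμ.isNat_of_maps hm).2 hjn with h | rfl | h
        exacts [mem_trans hkm h hjn, hkm, (hjm h).elim]
      have hil := hs'd.lt_of_lt (isNatInitial_of_isNat hd) hk' hl hkj
      obtain ⟨k', hk'⟩ := hlow (hseq n' s' hn' hs') hl (succ_le (hd.mem (hs'd.of_maps hl).1) hil)
      exact ⟨n', s', k', hn', hs', hk'⟩
  refine ⟨x, ⟨isReal_iff.2 ⟨fun p hp => ?_, fun i hi => ?_, fun i i' a b hii ha hb => ?_⟩,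
    fun u hu hux => ?_⟩, fun n s m hs hm j hjm => ⟨?_, ?_⟩⟩
  · obtain ⟨n, s, hn, hs, hp⟩ := (hx p).1 hp
    obtain ⟨d, hd, hsd⟩ := hseq n s hn hs
    obtain ⟨i, k, hi, hk, hp⟩ := hsd.1 p hp
    exact ⟨i, k, hd.mem hi, hk, hp⟩
  · obtain ⟨n, s, k, hn, hs, hk⟩ := hxex i hi
    have hk' := (hxm i k).2 ⟨n, s, hn, hs, hk⟩
    exact ⟨k, hk', fun l hl => hxfun i l k hl hk'⟩
  · obtain ⟨n, s, hn, hs, ha⟩ := (hxm i a).1 ha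
    obtain ⟨n', s', hn', hs', hb⟩ := (hxm i' b).1 hb
    obtain ⟨N, S, hN, hS, h1, h2⟩ := hdir n n' s s' hn hn' hs hs'
    obtain ⟨d, -, hd⟩ := hseq N S hN hS
    exact hd.2.2 i i' a b hii (h1.maps ha) (h2.maps hb)
  · obtain ⟨d, hd, hud⟩ := id hu
    obtain ⟨n, s, k, hn, hs, hk⟩ := hxex d hd
    -- A node defined at position `d` contains the initial segment `u` of length `d`, and `T` is
    -- closed under initial segments.
    refine hT.2.2 u s (hQT n s hn hs) hu (hud.subset_of_maps fun i l hl => ?_)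
    obtain ⟨l', hl'⟩ := hlow (hseq n s hn hs) hk (Or.inl (hud.of_maps hl).1)
    rwa [hxfun i l l' (hux.maps hl) ((hxm i l').2 ⟨n, s, hn, hs, hl'⟩)]
  · rintro ⟨i, hi⟩
    obtain ⟨n', s', hn', hs', hj⟩ := (hxm i j).1 hi
    have hn := (hμ.isNat_of_maps hm).1
    rcases mem_trichotomy hn hn' with h | rfl | h
    · exact (hmono n' n s s' hn' h hs hs').2 m hm j ⟨i, hj⟩ hjm
    · exact huniq n s' s hn hs' hs ▸ ⟨i, hj⟩
    · exact ⟨i, (hmono n n' s' s hn h hs' hs).1.maps hj⟩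
  · rintro ⟨i, hi⟩
    exact ⟨i, (hxm i j).2 ⟨n, s, (hμ.isNat_of_maps hm).1, hs, hi⟩⟩

end Trees

/-! ### Construction of interlaced branches -/

section Construction

variable {M : Type u} (E : M → M → Prop)

/-- `p` is the quadruple of `a`, `b`, `c` and `m`. -/
def IsQuadruple (p a b c m : M) : Prop :=
  ∃ u v, IsPair E u a b ∧ IsPair E v c m ∧ IsPair E p u v

/-- `s` is an `ω`-splitting node of `T` with all values below `m`. -/
def IsNodeBelow (T m s : M) : Prop :=
  E s T ∧ IsOmegaSplitting E T s ∧ ∀ j, InRange E s j → E j m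

/-- `b` is extended to `b'`; then, if `n` is a value of `r`, `c` is extended to `c'`; then `a` is
extended to `a'`. -/
def IsStage (T r n a b c m a' b' c' m' : M) : Prop :=
  ∃ m₁ m₂, LeastExtends E T b m b' m₁ ∧
    (InRange E r n ∧ LeastExtends E T c m₁ c' m₂ ∨ ¬ InRange E r n ∧ c' = c ∧ m₂ = m₁) ∧
    LeastExtends E T a m₂ a' m'

/-- `p` is a quadruple of three nodes and a bound on their values. -/
def IsState (T p : M) : Prop :=
  ∃ a b c m, IsQuadruple E p a b c m ∧ IsNat E m ∧ IsNodeBelow E T m a ∧ IsNodeBelow E T m b ∧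
    IsNodeBelow E T m c

/-- The state `q` is the successor of the state `p` at stage `n`. -/
def IsNextState (T r n p q : M) : Prop :=
  ∃ a b c m, IsQuadruple E p a b c m ∧
    ∃ a' b' c' m', IsQuadruple E q a' b' c' m' ∧ IsStage E T r n a b c m a' b' c' m'

variable {E}

section Instances

variable (a b c d e f g h i j k : (ℕ → M) → M) [DfnTerm a] [DfnTerm b] [DfnTerm c] [DfnTerm d]
  [DfnTerm e] [DfnTerm f] [DfnTerm g] [DfnTerm h] [DfnTerm i] [DfnTerm j] [DfnTerm k]

instance : Dfn E (fun v => IsQuadruple E (a v) (b v) (c v) (d v) (e v)) := by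
  unfold IsQuadruple; infer_instance

instance : Dfn E (fun v => IsNodeBelow E (a v) (b v) (c v)) := by
  unfold IsNodeBelow; infer_instance

instance : Dfn E (fun v => IsStage E (a v) (b v) (c v) (d v) (e v) (f v) (g v) (h v) (i v)
    (j v) (k v)) := by
  unfold IsStage; infer_instance

instance : Dfn E (fun v => IsState E (a v) (b v)) := by unfold IsState; infer_instance

instance : Dfn E (fun v => IsNextState E (a v) (b v) (c v) (d v) (e v)) := by
  unfold IsNextState; infer_instance

end Instances

theorem Extends.isNodeBelow {T s m t m' : M} (h : Extends E T s m t m') :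
    IsNodeBelow E T m' t := ⟨h.2.1, h.2.2.1, h.2.2.2.2.2.2⟩

theorem IsQuadruple.inj {p a b c m a' b' c' m' : M}
    (h : IsQuadruple E p a b c m) (h' : IsQuadruple E p a' b' c' m') :
    a = a' ∧ b = b' ∧ c = c' ∧ m = m' := by
  obtain ⟨u, v, hu, hv, hp⟩ := h
  obtain ⟨u', v', hu', hv', hp'⟩ := h'
  obtain ⟨rfl, rfl⟩ := hp.inj hp'
  obtain ⟨rfl, rfl⟩ := hu.inj hu'
  obtain ⟨rfl, rfl⟩ := hv.inj hv'
  exact ⟨rfl, rfl, rfl, rfl⟩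

variable [hM : Fact (IsModelZF E)]

theorem exists_isQuadruple (a b c m : M) : ∃ p, IsQuadruple E p a b c m := by
  obtain ⟨u, hu⟩ := exists_pair (E := E) a b
  obtain ⟨v, hv⟩ := exists_pair (E := E) c m
  obtain ⟨p, hp⟩ := exists_pair (E := E) u v
  exact ⟨p, u, v, hu, hv, hp⟩

theorem IsQuadruple.unique {p q a b c m : M} (h : IsQuadruple E p a b c m)
    (h' : IsQuadruple E q a b c m) : p = q := by
  obtain ⟨u, v, hu, hv, hp⟩ := h
  obtain ⟨u', v', hu', hv', hp'⟩ := h'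
  obtain rfl := hu.unique hu'
  obtain rfl := hv.unique hv'
  exact hp.unique hp'

theorem IsNodeBelow.mono {T m m' s : M} (h : IsNodeBelow E T m s) (hm : m = m' ∨ E m m')
    (hm' : IsNat E m') : IsNodeBelow E T m' s := by
  refine ⟨h.1, h.2.1, fun j hj => ?_⟩
  rcases hm with rfl | hm
  exacts [h.2.2 j hj, mem_trans (h.2.2 j hj) hm hm']

theorem IsStage.le {T r n a b c m a' b' c' m' m₁ m₂ : M} (hm : IsNat E m)
    (h₁ : LeastExtends E T b m b' m₁)
    (h₂ : InRange E r n ∧ LeastExtends E T c m₁ c' m₂ ∨ ¬ InRange E r n ∧ c' = c ∧ m₂ = m₁)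
    (h₃ : LeastExtends E T a m₂ a' m') :
    E m m₁ ∧ (m₁ = m₂ ∨ E m₁ m₂) ∧ E m₂ m' ∧ IsNat E m₁ ∧ IsNat E m₂ ∧ IsNat E m' := by
  have hm₁ := h₁.1.1
  have h12 : (m₁ = m₂ ∨ E m₁ m₂) ∧ IsNat E m₂ := by
    rcases h₂ with ⟨-, h⟩ | ⟨-, -, rfl⟩
    exacts [⟨Or.inr (h.1.lt hm₁), h.1.1⟩, ⟨Or.inl rfl, hm₁⟩]
  exact ⟨h₁.1.lt hm, h12.1, h₃.1.lt h12.2, hm₁, h12.2, h₃.1.1⟩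

theorem exists_isStage {T r n a b c m : M} (hT : IsSuperperfectTree E T) (hm : IsNat E m)
    (ha : IsNodeBelow E T m a) (hb : IsNodeBelow E T m b) (hc : IsNodeBelow E T m c) :
    ∃ a' b' c' m', IsStage E T r n a b c m a' b' c' m' := by
  obtain ⟨b', m₁, h₁⟩ := exists_leastExtends hT hb.2.1 hm
  obtain ⟨c', m₂, h₂⟩ : ∃ c' m₂, InRange E r n ∧ LeastExtends E T c m₁ c' m₂ ∨
      ¬ InRange E r n ∧ c' = c ∧ m₂ = m₁ := by
    by_cases hn : InRange E r n
    · obtain ⟨c', m₂, h₂⟩ := exists_leastExtends hT hc.2.1 h₁.1.1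
      exact ⟨c', m₂, Or.inl ⟨hn, h₂⟩⟩
    · exact ⟨c, m₁, Or.inr ⟨hn, rfl, rfl⟩⟩
  have hm₂ : IsNat E m₂ := by
    rcases h₂ with ⟨-, h⟩ | ⟨-, -, rfl⟩
    exacts [h.1.1, h₁.1.1]
  obtain ⟨a', m', h₃⟩ := exists_leastExtends hT ha.2.1 hm₂
  exact ⟨a', b', c', m', m₁, m₂, h₁, h₂, h₃⟩

theorem IsStage.unique {T r n a b c m a' b' c' m' a'' b'' c'' m'' : M}
    (h : IsStage E T r n a b c m a' b' c' m') (h' : IsStage E T r n a b c m a'' b'' c'' m'') :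
    a' = a'' ∧ b' = b'' ∧ c' = c'' ∧ m' = m'' := by
  obtain ⟨m₁, m₂, h₁, h₂, h₃⟩ := h
  obtain ⟨l₁, l₂, k₁, k₂, k₃⟩ := h'
  obtain ⟨rfl, rfl⟩ := h₁.unique k₁
  obtain ⟨rfl, rfl⟩ : c' = c'' ∧ m₂ = l₂ := by
    rcases h₂ with ⟨hn, h₂⟩ | ⟨hn, rfl, rfl⟩
    · exact h₂.unique (k₂.resolve_right fun h => h.1 hn).2
    · obtain ⟨-, rfl, rfl⟩ := k₂.resolve_left fun h => hn h.1
      exact ⟨rfl, rfl⟩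
  obtain ⟨rfl, rfl⟩ := h₃.unique k₃
  exact ⟨rfl, rfl, rfl, rfl⟩

theorem IsStage.isNodeBelow {T r n a b c m a' b' c' m' : M} (hm : IsNat E m)
    (hc : IsNodeBelow E T m c) (h : IsStage E T r n a b c m a' b' c' m') :
    IsNat E m' ∧ IsNodeBelow E T m' a' ∧ IsNodeBelow E T m' b' ∧ IsNodeBelow E T m' c' := by
  obtain ⟨m₁, m₂, h₁, h₂, h₃⟩ := h
  obtain ⟨hmm₁, hm₁₂, hm₂', hm₁, hm₂, hm'⟩ := IsStage.le hm h₁ h₂ h₃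
  have h₁' := h₁.1.isNodeBelow.mono hm₁₂ hm₂
  have h₂' : IsNodeBelow E T m₂ c' := by
    rcases h₂ with ⟨-, h⟩ | ⟨-, rfl, rfl⟩
    exacts [h.1.isNodeBelow, hc.mono (Or.inr hmm₁) hm₁]
  exact ⟨hm', h₃.1.isNodeBelow, h₁'.mono (Or.inr hm₂') hm', h₂'.mono (Or.inr hm₂') hm'⟩

/-- The sequence of states. -/
theorem exists_states {T r : M} (hT : IsSuperperfectTree E T) :
    ∃ F, (∀ n, IsNat E n → ∃! p, Maps E F n p) ∧
      (∀ n p, IsNat E n → Maps E F n p → IsState E T p) ∧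
      ∀ n p q, IsNat E n → Maps E F n p → Maps E F (succ E n) q → IsNextState E T r n p q := by
  obtain ⟨s₀, hs₀⟩ := hT.1.1
  obtain ⟨s, hs, -, hsplit⟩ := hT.2 s₀ hs₀
  obtain ⟨m, hm, hbd⟩ := (hT.1.2.1 s hs).exists_bound
  obtain ⟨p₀, hp₀⟩ := exists_isQuadruple (E := E) s s s m
  have hnode : IsNodeBelow E T m s := ⟨hs, hsplit, hbd⟩
  have hnext : ∀ n p, IsNat E n → IsState E T p → ∃! q, IsNextState E T r n p q := by
    rintro n p hn ⟨a, b, c, m, hp, hm, ha, hb, hc⟩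
    obtain ⟨a', b', c', m', h⟩ := exists_isStage (r := r) (n := n) hT hm ha hb hc
    obtain ⟨q, hq⟩ := exists_isQuadruple (E := E) a' b' c' m'
    refine ⟨q, ⟨a, b, c, m, hp, a', b', c', m', hq, h⟩, ?_⟩
    rintro q' ⟨a₁, b₁, c₁, m₁, hp', a₂, b₂, c₂, m₂, hq', h'⟩
    obtain ⟨rfl, rfl, rfl, rfl⟩ := hp.inj hp'
    obtain ⟨rfl, rfl, rfl, rfl⟩ := h.unique h'
    exact hq'.unique hq
  have hstate : ∀ n p q, IsState E T p → IsNextState E T r n p q → IsState E T q := by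
    rintro n p q ⟨a, b, c, m, hp, hm, ha, hb, hc⟩ ⟨a₁, b₁, c₁, m₁, hp', a₂, b₂, c₂, m₂, hq, h⟩
    obtain ⟨rfl, rfl, rfl, rfl⟩ := hp.inj hp'
    exact ⟨a₂, b₂, c₂, m₂, hq, h.isNodeBelow hm hc⟩
  obtain ⟨F, hF, hFX, -, hFs⟩ := exists_rec (E := E) (fun n p q => IsNextState E T r n p q)
    (fun p => IsState E T p) p₀ ⟨s, s, s, m, hp₀, hm, hnode, hnode, hnode⟩ hnext hstate
  exact ⟨F, hF, hFX, hFs⟩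

/-- A stage has bounds `m < m₁ ≤ m₂ < m'`, where `m = μ(n)` and `m' = μ(n + 1)`. New values of `y`
fall in `[m, m₁)`, those of `z` in `[m₁, m₂)` and those of `x` in `[m₂, m')`, which gives the
required order within each block. -/
theorem exists_interlaced {T r : M} (hT : IsSuperperfectTree E T) (hr : IsReal E r) :
    ∃ x y z μ, IsBranch E T x ∧ IsBranch E T y ∧ IsBranch E T z ∧ Interlaced E r x y z μ := by
  obtain ⟨F, hF, hFX, hFs⟩ := exists_states (r := r) hT
  let St : M → M → M → M → M → Prop := fun n a b c m =>
    ∃ p, Maps E F n p ∧ IsQuadruple E p a b c m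
  have hex : ∀ n, IsNat E n → ∃ a b c m, St n a b c m := by
    intro n hn
    obtain ⟨p, hp, -⟩ := hF n hn
    obtain ⟨a, b, c, m, hp', -⟩ := hFX n p hn hp
    exact ⟨a, b, c, m, p, hp, hp'⟩
  have huniq : ∀ {n a b c m a' b' c' m'}, IsNat E n → St n a b c m → St n a' b' c' m' →
      a = a' ∧ b = b' ∧ c = c' ∧ m = m' := by
    rintro n a b c m a' b' c' m' hn ⟨p, hp, h⟩ ⟨q, hq, h'⟩
    obtain rfl := (hF n hn).unique hp hq
    exact h.inj h'
  have hgood : ∀ {n a b c m}, IsNat E n → St n a b c m →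
      IsNat E m ∧ IsNodeBelow E T m a ∧ IsNodeBelow E T m b ∧ IsNodeBelow E T m c := by
    rintro n a b c m hn ⟨p, hp, h⟩
    obtain ⟨a', b', c', m', h', hgood⟩ := hFX n p hn hp
    obtain ⟨rfl, rfl, rfl, rfl⟩ := h.inj h'
    exact hgood
  have hstage : ∀ {n a b c m a' b' c' m'}, IsNat E n → St n a b c m →
      St (succ E n) a' b' c' m' → IsStage E T r n a b c m a' b' c' m' := by
    rintro n a b c m a' b' c' m' hn ⟨p, hp, h⟩ ⟨q, hq, h'⟩
    obtain ⟨a₁, b₁, c₁, m₁, h₁, a₂, b₂, c₂, m₂, h₂, hs⟩ := hFs n p q hn hp hq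
    obtain ⟨rfl, rfl, rfl, rfl⟩ := h.inj h₁
    obtain ⟨rfl, rfl, rfl, rfl⟩ := h'.inj h₂
    exact hs
  obtain ⟨μ, hμ, hμ'⟩ : ∃ μ, IsReal E μ ∧
      ∀ n m, Maps E μ n m ↔ IsNat E n ∧ ∃ a b c, St n a b c m := by
    refine exists_isReal_of_step (E := E) (fun n m => ∃ a b c, St n a b c m) ?_ ?_ ?_
    · intro n hn
      obtain ⟨a, b, c, m, h⟩ := hex n hn
      exact ⟨m, ⟨a, b, c, h⟩, fun m' ⟨a', b', c', h'⟩ => (huniq hn h' h).2.2.2⟩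
    · exact fun n m hn ⟨a, b, c, h⟩ => (hgood hn h).1
    · rintro n m m' hn ⟨a, b, c, h⟩ ⟨a', b', c', h'⟩
      obtain ⟨m₁, m₂, h₁, h₂, h₃⟩ := hstage hn h h'
      have hm := (hgood hn h).1
      obtain ⟨hmm₁, hm₁₂, hm₂', hm₁, hm₂, hm'⟩ := IsStage.le hm h₁ h₂ h₃
      rcases hm₁₂ with rfl | hm₁₂
      exacts [mem_trans hmm₁ hm₂' hm', mem_trans hmm₁ (mem_trans hm₁₂ hm₂' hm') hm']
  have hμSt : ∀ {n a b c m}, IsNat E n → St n a b c m → Maps E μ n m :=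
    fun hn h => (hμ' _ _).2 ⟨hn, _, _, _, h⟩
  have hμeq : ∀ {n a b c m l}, IsNat E n → St n a b c m → Maps E μ n l → l = m :=
    fun hn h hl => hμ.functional hl (hμSt hn h)
  have hle : ∀ {j m m'}, IsNat E m' → E m m' → ¬ E j m' → ¬ E j m :=
    fun hm' h hj hjm => hj (mem_trans hjm h hm')
  have hle' : ∀ {j m m'}, IsNat E m' → (m = m' ∨ E m m') → ¬ E j m' → ¬ E j m := by
    rintro j m m' hm' (rfl | h) hj
    exacts [hj, hle hm' h hj]
  have hfacts : ∀ {n a b c m a' b' c' m'}, IsNat E n → St n a b c m →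
      St (succ E n) a' b' c' m' → ∃ m₁ m₂, IsNat E m₁ ∧ IsNat E m₂ ∧ IsNat E m' ∧
        E m m₁ ∧ (m₁ = m₂ ∨ E m₁ m₂) ∧ E m₂ m' ∧ Extends E T b m b' m₁ ∧
        Extends E T a m₂ a' m' ∧ (InRange E r n ∧ Extends E T c m₁ c' m₂ ∨
          ¬ InRange E r n ∧ c' = c ∧ m₂ = m₁) := by
    intro n a b c m a' b' c' m' hn h h'
    obtain ⟨m₁, m₂, h₁, h₂, h₃⟩ := hstage hn h h'
    obtain ⟨hmm₁, hm₁₂, hm₂', hm₁, hm₂, hm'⟩ := IsStage.le (hgood hn h).1 h₁ h₂ h₃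
    exact ⟨m₁, m₂, hm₁, hm₂, hm', hmm₁, hm₁₂, hm₂', h₁.1, h₃.1,
      h₂.imp_left fun h => ⟨h.1, h.2.1⟩⟩
  obtain ⟨x, hxT, hx⟩ := exists_branch_of_nodes hT.1 hμ (fun n s => ∃ b c m, St n s b c m)
    (fun n hn => by
      obtain ⟨a, b, c, m, h⟩ := hex n hn
      exact ⟨a, b, c, m, h⟩)
    (fun n s t hn ⟨_, _, _, h⟩ ⟨_, _, _, h'⟩ => (huniq hn h h').1)
    (fun n s hn ⟨_, _, _, h⟩ => (hgood hn h).2.1.1)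
    (fun n s l ⟨_, _, m, h⟩ hl => by
      have hn := (hμ.isNat_of_maps hl).1
      obtain rfl := hμeq hn h hl
      exact (hgood hn h).2.1.2.2)
    (fun n s t l ⟨_, _, m, h⟩ ⟨_, _, _, h'⟩ hl => by
      have hn := (hμ.isNat_of_maps hl).1
      obtain rfl := hμeq hn h hl
      obtain ⟨m₁, m₂, hm₁, hm₂, hm', hmm₁, hm₁₂, hm₂', h₁, h₃, h₂⟩ := hfacts hn h h'
      exact ⟨h₃.2.2.2.1, fun j hj => (h₃.2.2.2.2.1 j hj).imp_right fun hj =>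
        hle hm₁ hmm₁ (hle' hm₂ hm₁₂ hj)⟩)
    (fun n l hn hl => by
      obtain ⟨a, b, c, m, h⟩ := hex n hn
      obtain ⟨a', b', c', m', h'⟩ := hex _ hn.succ
      obtain rfl := hμeq hn h hl
      obtain ⟨m₁, m₂, hm₁, hm₂, hm', hmm₁, hm₁₂, hm₂', h₁, h₃, h₂⟩ := hfacts hn h h'
      obtain ⟨j, hj, hjm⟩ := h₃.2.2.2.2.2.1
      exact ⟨succ E n, a', j, hn.succ, mem_succ_self n, ⟨b', c', m', h'⟩, hj,
        hle hm₁ hmm₁ (hle' hm₂ hm₁₂ hjm)⟩)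
  obtain ⟨y, hyT, hy⟩ := exists_branch_of_nodes hT.1 hμ (fun n s => ∃ a c m, St n a s c m)
    (fun n hn => by
      obtain ⟨a, b, c, m, h⟩ := hex n hn
      exact ⟨b, a, c, m, h⟩)
    (fun n s t hn ⟨_, _, _, h⟩ ⟨_, _, _, h'⟩ => (huniq hn h h').2.1)
    (fun n s hn ⟨_, _, _, h⟩ => (hgood hn h).2.2.1.1)
    (fun n s l ⟨_, _, m, h⟩ hl => by
      have hn := (hμ.isNat_of_maps hl).1
      obtain rfl := hμeq hn h hl
      exact (hgood hn h).2.2.1.2.2)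
    (fun n s t l ⟨_, _, m, h⟩ ⟨_, _, _, h'⟩ hl => by
      have hn := (hμ.isNat_of_maps hl).1
      obtain rfl := hμeq hn h hl
      obtain ⟨m₁, m₂, hm₁, hm₂, hm', hmm₁, hm₁₂, hm₂', h₁, h₃, h₂⟩ := hfacts hn h h'
      exact ⟨h₁.2.2.2.1, h₁.2.2.2.2.1⟩)
    (fun n l hn hl => by
      obtain ⟨a, b, c, m, h⟩ := hex n hn
      obtain ⟨a', b', c', m', h'⟩ := hex _ hn.succ
      obtain rfl := hμeq hn h hl
      obtain ⟨m₁, m₂, hm₁, hm₂, hm', hmm₁, hm₁₂, hm₂', h₁, h₃, h₂⟩ := hfacts hn h h'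
      obtain ⟨j, hj, hjm⟩ := h₁.2.2.2.2.2.1
      exact ⟨succ E n, b', j, hn.succ, mem_succ_self n, ⟨a', c', m', h'⟩, hj, hjm⟩)
  obtain ⟨z, hzT, hz⟩ := exists_branch_of_nodes hT.1 hμ (fun n s => ∃ a b m, St n a b s m)
    (fun n hn => by
      obtain ⟨a, b, c, m, h⟩ := hex n hn
      exact ⟨c, a, b, m, h⟩)
    (fun n s t hn ⟨_, _, _, h⟩ ⟨_, _, _, h'⟩ => (huniq hn h h').2.2.1)
    (fun n s hn ⟨_, _, _, h⟩ => (hgood hn h).2.2.2.1)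
    (fun n s l ⟨_, _, m, h⟩ hl => by
      have hn := (hμ.isNat_of_maps hl).1
      obtain rfl := hμeq hn h hl
      exact (hgood hn h).2.2.2.2.2)
    (fun n s t l ⟨_, _, m, h⟩ ⟨_, _, _, h'⟩ hl => by
      have hn := (hμ.isNat_of_maps hl).1
      obtain rfl := hμeq hn h hl
      obtain ⟨m₁, m₂, hm₁, hm₂, hm', hmm₁, hm₁₂, hm₂', h₁, h₃, h₂⟩ := hfacts hn h h'
      rcases h₂ with ⟨-, h₂⟩ | ⟨-, rfl, -⟩
      · exact ⟨h₂.2.2.2.1, fun j hj => (h₂.2.2.2.2.1 j hj).imp_right fun hj => hle hm₁ hmm₁ hj⟩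
      · exact ⟨fun _ h => h, fun _ hj => Or.inl hj⟩)
    (fun n l hn hl => by
      -- The nodes for `z` grow only at stages that are values of `r`; such a stage `k > n` exists
      -- because `r` is unbounded.
      obtain ⟨i, k, hi, hni, hik, hnk⟩ := hr.exists_maps_gt hn
      have hk := (hr.isNat_of_maps hik).2
      obtain ⟨a, b, c, m, h⟩ := hex k hk
      obtain ⟨a', b', c', m', h'⟩ := hex _ hk.succ
      obtain ⟨m₁, m₂, hm₁, hm₂, hm', hmm₁, hm₁₂, hm₂', h₁, h₃, h₂⟩ := hfacts hk h h'
      obtain ⟨-, h₂⟩ := h₂.resolve_right fun h => h.1 ⟨i, hik⟩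
      obtain ⟨j, hj, hjm⟩ := h₂.2.2.2.2.2.1
      exact ⟨succ E k, c', j, hk.succ, mem_trans hnk (mem_succ_self k) hk.succ,
        ⟨a', b', m', h'⟩, hj, hle (hgood hk h).1 (hμ.lt hnk hl (hμSt hk h)) (hle hm₁ hmm₁ hjm)⟩)
  have hblock : ∀ {n a b c m a' b' c' m'}, IsNat E n → St n a b c m →
      St (succ E n) a' b' c' m' → ∀ j, InBlock E μ n j ↔ ¬ E j m ∧ E j m' := by
    intro n a b c m a' b' c' m' hn h h' j
    constructor
    · rintro ⟨s, l, l', hs, hl, hl', hj⟩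
      obtain rfl := isSucc_iff.1 hs
      obtain rfl := hμeq hn h hl
      obtain rfl := hμeq hn.succ h' hl'
      exact hj
    · exact fun hj => ⟨succ E n, m, m', isSucc_iff.2 rfl, hμSt hn h, hμSt hn.succ h', hj⟩
  have hsts : ∀ n, IsNat E n → ∃ a b c m a' b' c' m' m₁ m₂, St n a b c m ∧
      (∀ j, InBlock E μ n j ↔ ¬ E j m ∧ E j m') ∧
      (∀ j, E j m' → (InRange E x j ↔ InRange E a' j)) ∧
      (∀ j, E j m' → (InRange E y j ↔ InRange E b' j)) ∧
      (∀ j, E j m' → (InRange E z j ↔ InRange E c' j)) ∧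
      IsNat E m₁ ∧ IsNat E m₂ ∧ IsNat E m' ∧
        E m m₁ ∧ (m₁ = m₂ ∨ E m₁ m₂) ∧ E m₂ m' ∧ Extends E T b m b' m₁ ∧
        Extends E T a m₂ a' m' ∧ (InRange E r n ∧ Extends E T c m₁ c' m₂ ∨
          ¬ InRange E r n ∧ c' = c ∧ m₂ = m₁) := by
    intro n hn
    obtain ⟨a, b, c, m, h⟩ := hex n hn
    obtain ⟨a', b', c', m', h'⟩ := hex _ hn.succ
    obtain ⟨m₁, m₂, hf⟩ := hfacts hn h h'
    exact ⟨a, b, c, m, a', b', c', m', m₁, m₂, h, hblock hn h h',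
      hx _ a' m' ⟨b', c', m', h'⟩ (hμSt hn.succ h'), hy _ b' m' ⟨a', c', m', h'⟩ (hμSt hn.succ h'),
      hz _ c' m' ⟨a', b', m', h'⟩ (hμSt hn.succ h'), hf⟩
  have hlt : ∀ {i j m}, IsNat E m → IsNat E j → E i m → ¬ E j m → E i j := by
    intro i j m hm hj him hjm
    rcases mem_trichotomy hm hj with h | rfl | h
    exacts [mem_trans him h hj, him, (hjm h).elim]
  refine ⟨x, y, z, μ, hxT, hyT, hzT, ⟨hr, hxT.1, hyT.1, hzT.1, hμ⟩, ?_, ?_, ?_, ?_, ?_⟩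
  · intro n hn
    obtain ⟨a, b, c, m, a', b', c', m', m₁, m₂, h, hblk, hx', hy', hz', hm₁, hm₂, hm', hmm₁,
      hm₁₂, hm₂', h₁, h₃, h₂⟩ := hsts n hn
    obtain ⟨j, hj, hjm⟩ := h₃.2.2.2.2.2.1
    have hjm' := h₃.2.2.2.2.2.2 j hj
    exact ⟨j, (hx' j hjm').2 hj, (hblk j).2 ⟨hle hm₁ hmm₁ (hle' hm₂ hm₁₂ hjm), hjm'⟩⟩
  · intro n hn
    obtain ⟨a, b, c, m, a', b', c', m', m₁, m₂, h, hblk, hx', hy', hz', hm₁, hm₂, hm', hmm₁,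
      hm₁₂, hm₂', h₁, h₃, h₂⟩ := hsts n hn
    obtain ⟨j, hj, hjm⟩ := h₁.2.2.2.2.2.1
    have hjm' : E j m' := by
      have := h₁.2.2.2.2.2.2 j hj
      rcases hm₁₂ with rfl | h12
      exacts [mem_trans this hm₂' hm', mem_trans (mem_trans this h12 hm₂) hm₂' hm']
    exact ⟨j, (hy' j hjm').2 hj, (hblk j).2 ⟨hjm, hjm'⟩⟩
  · intro n hn
    obtain ⟨a, b, c, m, a', b', c', m', m₁, m₂, h, hblk, hx', hy', hz', hm₁, hm₂, hm', hmm₁,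
      hm₁₂, hm₂', h₁, h₃, h₂⟩ := hsts n hn
    constructor
    · rintro ⟨j, hj, hj'⟩
      rw [hblk] at hj'
      rw [hz' j hj'.2] at hj
      -- If `n` is not a value of `r`, the node `c` is unchanged and all its values lie below the
      -- block.
      refine by_contra fun hnr => ?_
      obtain ⟨-, rfl, -⟩ := h₂.resolve_left fun h => hnr h.1
      exact hj'.1 ((hgood hn h).2.2.2.2.2 j hj)
    · intro hnr
      obtain ⟨-, h₂⟩ := h₂.resolve_right fun h => h.1 hnr
      obtain ⟨j, hj, hjm⟩ := h₂.2.2.2.2.2.1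
      have hjm' := mem_trans (h₂.2.2.2.2.2.2 j hj) hm₂' hm'
      exact ⟨j, (hz' j hjm').2 hj, (hblk j).2 ⟨hle hm₁ hmm₁ hjm, hjm'⟩⟩
  · intro n i j hi hj hi' hj'
    have hn := (hi'.isNat hμ).1
    have hjn := (hj'.isNat hμ).2
    obtain ⟨a, b, c, m, a', b', c', m', m₁, m₂, h, hblk, hx', hy', hz', hm₁, hm₂, hm', hmm₁,
      hm₁₂, hm₂', h₁, h₃, h₂⟩ := hsts n hn
    rw [hblk] at hi' hj'
    rw [hy' i hi'.2] at hi
    rw [hx' j hj'.2] at hj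
    -- Values of the old node `a` lie below `m`, so a value of `x` in the block is new and hence at
    -- least `m₂`.
    have hjm₂ := (h₃.2.2.2.2.1 j hj).resolve_left fun h' =>
      hj'.1 ((hgood hn h).2.1.2.2 j h')
    exact hlt hm₁ hjn (h₁.2.2.2.2.2.2 i hi) (hle' hm₂ hm₁₂ hjm₂)
  · intro n i j hi hj hi' hj'
    have hn := (hi'.isNat hμ).1
    have hjn := (hj'.isNat hμ).2
    obtain ⟨a, b, c, m, a', b', c', m', m₁, m₂, h, hblk, hx', hy', hz', hm₁, hm₂, hm', hmm₁,
      hm₁₂, hm₂', h₁, h₃, h₂⟩ := hsts n hn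
    rw [hblk] at hi' hj'
    rw [hz' i hi'.2] at hi
    rw [hx' j hj'.2] at hj
    have hjm₂ := (h₃.2.2.2.2.1 j hj).resolve_left fun h' =>
      hj'.1 ((hgood hn h).2.1.2.2 j h')
    rcases h₂ with ⟨-, h₂⟩ | ⟨-, rfl, -⟩
    · exact hlt hm₂ hjn (h₂.2.2.2.2.2.2 i hi) hjm₂
    · exact (hi'.1 ((hgood hn h).2.2.2.2.2 i hi)).elim

end Construction

end SetModel

/-! ### Equality of the reals -/

theorem mainTheorem11 {V : Type*} (E : V → V → Prop) (hV : SetModel.IsModelZF E)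
    (W : Set V) (hW : SetModel.IsSubuniverse E W)
    (T : V) (hT : SetModel.IsSuperperfectTree E T)
    (hbranch : ∀ f : V, SetModel.IsBranch E T f → f ∈ W) :
    SetModel.reals E = Subtype.val '' SetModel.reals (SetModel.restrict E W) := by
  have : Fact (SetModel.IsModelZF E) := ⟨hV⟩
  have : Fact (SetModel.IsModelZF (SetModel.restrict E W)) := ⟨hW.isModelZF⟩
  ext r
  constructor
  · intro hr
    obtain ⟨x, y, z, μ, hx, hy, hz, h⟩ := SetModel.exists_interlaced hT hr
    have hrW := h.mem hW.transitive (hbranch x hx) (hbranch y hy) (hbranch z hz)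
    exact ⟨⟨r, hrW⟩, (SetModel.isReal_restrict hW.transitive).2 hr, rfl⟩
  · rintro ⟨s, hs, rfl⟩
    exact (SetModel.isReal_restrict hW.transitive).1 hs
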